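/- A *finite (soft) excursion* $\varepsilon$ is a walk $(\varepsilon(0),\dots,\varepsilon(2n))$, $n\ge 0$, with integer values, $|\varepsilon(i)-\varepsilon(i-1)|=1$, $\varepsilon(i)\ge 0$ and $\varepsilon(0)=\varepsilon(2n)=0$. Box $i\in\{1,\dots,2n\}$ contains a ball if $\varepsilon(i)-\varepsilon(i-1)=1$ and is empty otherwise; all boxes in $\mathbb Z\setminus\{1,\dots,2n\}$ are empty. The boxes $0$ and $2n+1$ are the *records* preceding and following the excursion. A *slot diagram* is a family of vectors $x=(x_k:1\le k\le M)$, $M\ge 0$, $x_k=(x_k(0),\dots,x_k(s_k-1))\in\mathbb N^{s_k}$ (where $\mathbb N\ni 0$), such that $s_k=1+2\sum_{i=k+1}^{M}(i-k)n_i$ for $1\le k\le M$, where $n_i=\sum_j x_i(j)$; in particular $s_M=1$. *Head-tail (HT) decomposition and $x^{\diamond}[\varepsilon]$.* A run is a maximal set of neighbouring boxes that are all occupied or all empty. As long as there is a finite run, take the leftmost among the smallest runs; let $k$ be its number of boxes. If it is occupied, pair its boxes with the first $k$ boxes of the next run to its right; if it is empty, pair its boxes with the nearest $k$ boxes of the next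 run to its left. The $2k$ paired boxes form a $k$-soliton$^\diamond$ $\gamma$, with head $\mathtt h_1<\dots<\mathtt h_k$ (the occupied boxes) and tail $\mathtt t_1<\dots<\mathtt t_k$ (the empty boxes). Remove these boxes, form the runs of the remaining boxes, and repeat. For $k\ge 1$, a box of $\{0,\dots,2n\}$ is a $k$-slot$^\diamond$ if it is the record $0$, or if for some $m>k$ it is one of the boxes $\mathtt h_\ell,\mathtt t_{m-\ell+1}$, $1\le\ell\le m-k$, of an $m$-soliton$^\diamond$. The $k$-slots$^\diamond$ are numbered $0,1,2,\dots$ from left to right. A $k$-soliton$^\diamond$ is attached to $k$-slot$^\diamond$ number $i$ if all its boxes are strictly between the $k$-slots$^\diamond$ number $i$ and $i+1$, where the record $2n+1$ counts as the slot that follows the last one. Let $x^\diamond_k(i)$ be the number of $k$-solitons$^\diamond$ attached to $k$-slot$^\diamond$ number $i$, let $M^\diamond$ be the largest size of a soliton$^\diamond$ ($0$ if there is none), and $x^\diamond[\varepsilon]=(x^\diamond_k:1\le k\le M^\diamond)$. *Tree, branches and $x^{*}[\varepsilon]$.* Cut the region below the graph of $\varepsilon$ along the horizontal lines of integer height. The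 connected components are the nodes of a planar rooted tree, whose root is the bottom component and whose edges join components that share a piece of a line; the offspring of a node are ordered from left to right. The *generation number* of a node is the number of nodes on the longest path from it to a leaf, moving away from the root, so that a leaf has generation number $1$. Colour the nodes other than the root: each leaf gets a colour of its own, and each other node gets the colour of the rightmost among its offspring of largest generation number. The colour classes are the *branches*; a $k$-branch is one with $k$ nodes, together with the edge that joins its lowest node to the parent of that node. For $k\ge 1$ erase all branches with at most $k$ nodes. With the convention that the root has an additional edge from below, the edges of the remaining tree that are incident to a node cut a small circle around this node into arcs. Such an arc is a $k$-slot$^*$ if (a) it belongs to the root, or (b) it belongs to a node with generation number greater than $k+1$, or (c) it belongs to a node with generation number $k+1$ and all the $k$-node paths from an offspring of the node to a leaf are attached to the node to the right of the arc. The $k$-slots$^*$ are numbered $0,1,2,\dots$ from left to right, i.e. clockwise around the tree, starting at the edge below the root. Let $x^*_k(i)$ be the number of $k$-branches that are attached (in the tree from which only the branches with fewer than $k$ nodes have been erased) to $k$-slot$^*$ number $i$, let $M^*$ be the number of edges of the longest path from the root to a leaf, and $x^*[\varepsilon]=(x^*_k:1\le k\le M^*)$. **Proposition.** For every finite excursion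 $\varepsilon$, $x^\diamond[\varepsilon]$ is a slot diagram and $x^{\diamond}[\varepsilon]=x^{*}[\varepsilon]$; that is, $M^\diamond=M^*$, and for all $1\le k\le M^\diamond$ the vectors $x^\diamond_k$ and $x^*_k$ have the same number of entries and the same entries. -/

import Mathlib

/-!
# The head-tail slot diagram of an excursion and the slot diagram of its planar tree

A finite soft excursion, a nonnegative nearest neighbour walk `ε(0), …, ε(2n)` with
`ε(0) = ε(2n) = 0`, is identified with the list of its steps, that is, with a `DyckWord`
(`U` is an up-step, i.e. a ball, and `D` is a down-step, i.e. an empty box).  The empty excursion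
is the Dyck word `0`.

A family of vectors `(x_k : 1 ≤ k ≤ M)` is a `List (List ℕ)` of length `M`, whose entry number
`k - 1` is the list `x_k = (x_k(0), …, x_k(s_k - 1))`.
-/

namespace BoxBall

/-! ## Slot diagrams -/

/-- The vector `x_k` of the family `x = (x_1, …, x_M)`, for `1 ≤ k ≤ M`. -/
def component (x : List (List ℕ)) (k : ℕ) : List ℕ := x.getD (k - 1) []

/-- The family `(x_1, …, x_M)` is a slot diagram: for all `1 ≤ k ≤ M`, the vector `x_k` has
`s_k = 1 + 2 ∑_{i = k + 1}^{M} (i - k) n_i` entries, where `n_i` is the sum of the entries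
of `x_i`.  In particular `s_M = 1`. -/
def IsSlotDiagram (x : List (List ℕ)) : Prop :=
  ∀ k, 1 ≤ k → k ≤ x.length →
    (component x k).length =
      1 + 2 * ∑ i ∈ Finset.Ioc k x.length, (i - k) * (component x i).sum

/-! ## The head-tail decomposition of an excursion

The boxes of the excursion are `1, …, 2n`.  The box `0` is the record preceding the excursion and
the box `2n + 1` is the next record.  There are no balls outside of the excursion. -/

/-- The ball configuration of the excursion: box `i` holds a ball if and only if
`1 ≤ i ≤ 2n` and step number `i` of the excursion goes up. -/
def ball (ε : DyckWord) : ℕ → Bool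
  | 0 => false
  | i + 1 => ε.toList[i]? == some DyckStep.U

/-- A soliton: the boxes of its head (which hold balls) and of its tail (which are empty), both
listed from left to right. -/
structure Soliton where
  head : List ℕ
  tail : List ℕ

namespace Soliton

/-- A `k`-soliton has `k` boxes in its head (and `k` boxes in its tail). -/
def size (γ : Soliton) : ℕ := γ.head.length

/-- All boxes of the soliton. -/
def boxes (γ : Soliton) : List ℕ := γ.head ++ γ.tail

end Soliton

/-- The runs of the configuration `η` on the boxes in `l`, from left to right: the maximal
blocks of boxes that are neighbours in `l` and are all occupied or all empty. -/
def runs (η : ℕ → Bool) (l : List ℕ) : List (List ℕ) :=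
  l.splitBy fun a b => η a == η b

/-- All triples of consecutive entries of a list, from left to right. -/
def triples {α : Type*} : List α → List (α × α × α)
  | a :: b :: c :: l => (a, b, c) :: triples (b :: c :: l)
  | _ => []

/-- One round of the head-tail algorithm.  The list `l` consists of the boxes in `[0, 2n + 1]` that
have not been removed so far, so that its first and its last run are the visible parts of the two
semi-infinite empty runs (which are one infinite run if nothing else is left), and
the finite runs are the middle entries of the triples of consecutive runs.
Take the leftmost among the smallest finite runs, with `k` boxes say.  If it is occupied, pair it
with the first `k` boxes of the next run to its right.  If it is empty, pair it with the nearest,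
i.e. the last, `k` boxes of the next run to its left. The paired boxes are a soliton.
The value is `none` if there is no finite run. -/
def htRound (η : ℕ → Bool) (l : List ℕ) : Option Soliton :=
  ((triples (runs η l)).argmin fun t => t.2.1.length).map fun (left, run, right) =>
    if run.all η then ⟨run, right.take run.length⟩ else ⟨left.rtake run.length, run⟩

/-- The head-tail algorithm with at most the given number of rounds: after each round the boxes of
the soliton just found are removed, and the runs are formed anew. -/
def htLoop (η : ℕ → Bool) : ℕ → List ℕ → List Soliton
  | 0, _ => []
  | r + 1, l =>
    match htRound η l with
    | none => []
    | some γ => γ :: htLoop η r (l.filter fun i => i ∉ γ.boxes)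

/-- The head-tail decomposition of `ε`: all solitons that the algorithm finds before it stops.  Each
round removes a ball, and there are `n` balls, so `n` rounds suffice. -/
def htSolitons (ε : DyckWord) : List Soliton :=
  htLoop (ball ε) ε.semilength (List.range (2 * ε.semilength + 2))

/-- The box `i` is a `k`-slot of the head-tail decomposition: it is the record `0`, or there is an
`m`-soliton `γ` with `m > k` such that `i` is one of the first `m - k` boxes
`h_1, …, h_{m - k}` of the head of `γ`, or one of the last `m - k` boxes `t_{k + 1}, …, t_m` of
the tail of `γ`. -/
def IsHTSlot (ε : DyckWord) (k i : ℕ) : Prop :=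
  i = 0 ∨ ∃ γ ∈ htSolitons ε, k < γ.size ∧
    (i ∈ γ.head.take (γ.size - k) ∨ i ∈ γ.tail.drop k)

instance (ε : DyckWord) (k i : ℕ) : Decidable (IsHTSlot ε k i) := by
  unfold IsHTSlot; infer_instance

/-- The `k`-slots of the head-tail decomposition in the record `0` and the excursion, from left to
right, numbered `0, 1, 2, …`. -/
def htSlots (ε : DyckWord) (k : ℕ) : List ℕ :=
  (List.range (2 * ε.semilength + 1)).filter fun i => IsHTSlot ε k i

/-- The vector whose entry number `i` is the number of `k`-solitons of the head-tail decomposition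
that are attached to `k`-slot number `i`, i.e. all of whose boxes are strictly
between the `k`-slots number `i` and `i + 1`.  The slot that follows the last one
in the excursion is the next record, the box `2n + 1`. -/
def htVector (ε : DyckWord) (k : ℕ) : List ℕ :=
  List.zipWith
    (fun a b => (htSolitons ε).countP fun γ => γ.size = k ∧ ∀ j ∈ γ.boxes, a < j ∧ j < b)
    (htSlots ε k) ((htSlots ε k).tail ++ [2 * ε.semilength + 1])

/-- The largest size of a soliton of the head-tail decomposition, and `0` if there is none. -/
def htMax (ε : DyckWord) : ℕ := ((htSolitons ε).map Soliton.size).foldr max 0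

/-- The head-tail slot diagram of an excursion. -/
def htSlotDiagram (ε : DyckWord) : List (List ℕ) :=
  (List.range (htMax ε)).map fun j => htVector ε (j + 1)

/-! ## Planar rooted trees -/

/-- A finite planar rooted tree: a node with the ordered list, from left to right, of the
subtrees at its offspring. -/
inductive PlaneTree where
  | node (children : List PlaneTree) : PlaneTree

/-- The ordered list of the subtrees at the offspring of the root of the tree of `ε`.  If `ε` is
not empty it is a strict excursion, namely an up-step, an excursion `ε.insidePart` and the matching
down-step, followed by an excursion `ε.outsidePart`.  The matched pair of steps bounds the region
of the leftmost offspring of the root, the regions above it are those of `ε.insidePart`, and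
`ε.outsidePart` gives the further offspring of the root. -/
def forest (ε : DyckWord) : List PlaneTree :=
  if h : ε = 0 then [] else .node (forest ε.insidePart) :: forest ε.outsidePart
termination_by ε.semilength
decreasing_by
  · exact DyckWord.semilength_insidePart_lt h
  · exact DyckWord.semilength_outsidePart_lt h

/-- The planar rooted tree of the excursion `ε`.  Its nodes are the connected components
of the region below the graph of `ε` when this is cut along the lines of integer height; the root
is the bottom component, and the other nodes correspond to the matched pairs of an up-step and
a down-step. -/
def tree (ε : DyckWord) : PlaneTree := .node (forest ε)

namespace PlaneTree

mutual

/-- The generation number of a node: the number of nodes of the longest path from the node to a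
leaf, moving away from the root.  A leaf has generation number `1`. -/
def generation : PlaneTree → ℕ
  | node cs => maxGeneration cs + 1

/-- The largest generation number among the given nodes, and `0` if there are none. -/
def maxGeneration : List PlaneTree → ℕ
  | [] => 0
  | c :: cs => max c.generation (maxGeneration cs)

end

/-! The branches are the classes of the following colouring of the nodes other than the root.  A
leaf starts a new colour, and any other node has the colour of the rightmost among those of its
offspring that have the largest generation number.  The root has a colour of its own.
So a node is the lowest node of its branch if it is an offspring of the root, or if it is not
the offspring whose colour its parent has. The size (number of nodes) of the branch is then the
generation number of this lowest node. -/

/-- Is `c` the offspring whose colour its parent has?  Here `isRoot` tells whether the parent is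
the root, `g` is the largest generation number of the offspring of the parent, and `right` is
the list of the offspring of the parent to the right of `c`. -/
def continuesBranch (isRoot : Bool) (g : ℕ) (c : PlaneTree) (right : List PlaneTree) : Bool :=
  !isRoot && c.generation == g && decide (maxGeneration right < g)

mutual

/-- Erase all branches of size at most `k` from the tree, but remember where the `k`-branches
were.  The slots are the arcs into which the edges of the remaining tree cut the
circumferences of its nodes (where the root has an additional edge from below).  List the arcs at
the given node and at its descendants from left to right, i.e. in clockwise order around the tree
starting from the edge below the node.  Each arc comes with the truth value of
"this slot is a `k`-slot" and with the number of `k`-branches that were attached to it. -/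
def arcs (k : ℕ) (isRoot : Bool) : PlaneTree → List (Bool × ℕ)
  | node cs => arcsAux k isRoot (maxGeneration cs) false 0 cs

/-- The part of the list `arcs` at a node that begins with an arc that has been partially explored.
Here `g` is the largest generation number of the offspring of the node, `passed` tells whether the
arc has on its left a remaining offspring with generation number `k`, `a` is the number of
`k`-branches found so far in the arc, and the last argument is the list of offspring still to
be visited.

An arc is a `k`-slot in each of the following cases: (a) it belongs to the root; (b) it belongs to
a node with `g > k`, i.e. with more than `k` generations above the node;
(c) it belongs to a node with `g = k`, and each path with `k` nodes from an offspring
of the node to a leaf is attached to the node on the right of the arc.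

The offspring are visited from left to right.  An offspring that is the lowest node of
a branch of size less than `k` is erased; one that is the lowest node of a `k`-branch is erased and
counted in the present arc; any other remains, it closes the present arc, and a new arc begins
after it. -/
def arcsAux (k : ℕ) (isRoot : Bool) (g : ℕ) (passed : Bool) (a : ℕ) :
    List PlaneTree → List (Bool × ℕ)
  | [] => [(isRoot || decide (k < g) || (g == k && !passed), a)]
  | c :: cs =>
    if continuesBranch isRoot g c cs = false ∧ c.generation < k then
      arcsAux k isRoot g passed a cs
    else if continuesBranch isRoot g c cs = false ∧ c.generation = k then
      arcsAux k isRoot g passed (a + 1) cs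
    else
      (isRoot || decide (k < g) || (g == k && !passed), a) ::
        (arcs k false c ++ arcsAux k isRoot g (passed || c.generation == k) 0 cs)

end

/-- The vector whose entry number `i` is the number of `k`-branches attached to `k`-slot
number `i` of the tree; the `k`-slots are numbered from left to right. -/
def slotVector (t : PlaneTree) (k : ℕ) : List ℕ :=
  ((arcs k true t).filter fun p => p.1).map fun p => p.2

/-- The slot diagram of a planar rooted tree.  The number of its vectors is the length (the number
of edges) of the longest path from the root to a leaf, which is the size of the largest branch. -/
def slotDiagram (t : PlaneTree) : List (List ℕ) :=
  (List.range (t.generation - 1)).map fun j => t.slotVector (j + 1)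

end PlaneTree

/-- The slot diagram of the planar rooted tree of the excursion `ε`. -/
def treeSlotDiagram (ε : DyckWord) : List (List ℕ) := (tree ε).slotDiagram

end BoxBall

/-!
The solitons of the head-tail decomposition are the branches of the tree: if a branch is identified
with the boxes of its nodes, a node being a matched pair of an up-step and a down-step, then both
families consist of the same sets of boxes, with the same heads and tails.

To see this, let `k` be the number of boxes of the leftmost smallest run. The soliton found in this
round always consists of `k` balls followed by `k` empty boxes that are adjacent among the boxes
left, so it is a path of `k` nodes that ends in a leaf and has no ramification
(`BoxForest.exists_plug_tower`). It is a whole branch, as its lowest node either is an offspring of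
the root, or has a sibling that prevents it from having the colour of its parent. If the run on
the left of the path is longer than `k`, there is a sibling of larger generation number on the left;
otherwise the run on the right has at least `k` boxes, and there is a sibling on the right of at
least the same generation number (`BoxForest.exists_of_htRound`, `BoxForest.prunes_tower`). This is
where it matters that ties are resolved in favour of the leftmost run. Removing the boxes of this
branch leaves the word of the tree without the branch, whose other branches are unchanged, and
`BoxForest.perm_htLoop_branches` follows by induction. In order that the boxes keep their names
under removal, the argument takes place in forests with labelled nodes, `BoxForest`.

Hence a box is a `k`-slot of the head-tail decomposition if and only if it is the record or
belongs to a node of generation number larger than `k` (`BoxForest.mem_marks_iff`). The list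
`BoxForest.marks` records, in the order of the boxes, these slots and the first boxes of the
`k`-branches. Both vectors number `k` are obtained from it by counting the branches between
consecutive slots: `htVector_eq` for the head-tail decomposition, and `slotVector_tree` for the
tree, where a recursion on the forest matches the arcs that are slots with the boxes that are
slots. The length of the vector is one plus the number of slots in the list, and a branch of size
`m > k` accounts for `2 (m - k)` of them (`BoxForest.count_true_marks`), so it is a slot diagram.
-/

namespace BoxBall

/-! ### Planar forests with labelled boxes -/

/-- A planar forest whose nodes carry the two boxes of an excursion that they come from: `u` holds
the up-step and `d` the matching down-step of the leftmost root. A forest is encoded as a binary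
tree: `inner` is the forest of the offspring of the leftmost root, and `rest` consists of the trees
to its right. -/
inductive BoxForest where
  | nil : BoxForest
  | cons (u d : ℕ) (inner rest : BoxForest) : BoxForest

namespace BoxForest

/-- The boxes of the forest from left to right, in the order in which a clockwise walk around it
meets them. -/
def word : BoxForest → List ℕ
  | nil => []
  | cons u d i r => u :: (i.word ++ d :: r.word)

/-- The number of nodes on the longest path from a root to a leaf. The generation number of a node
is one more than the height of the forest of its offspring. -/
def height : BoxForest → ℕ
  | nil => 0
  | cons _ _ i r => max (i.height + 1) r.height

/-- The juxtaposition of two forests. -/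
def append : BoxForest → BoxForest → BoxForest
  | nil, G => G
  | cons u d i r, G => cons u d i (r.append G)

/-- All up-boxes of the forest hold balls of `η`, and all its down-boxes are empty. -/
def Coloured (η : ℕ → Bool) : BoxForest → Prop
  | nil => True
  | cons u d i r => η u = true ∧ η d = false ∧ i.Coloured η ∧ r.Coloured η

@[simp] theorem append_nil (F : BoxForest) : F.append nil = F := by
  induction F with
  | nil => rfl
  | cons u d i r _ ih => simp [append, ih]

theorem append_assoc (F G H : BoxForest) : (F.append G).append H = F.append (G.append H) := by
  induction F with
  | nil => rfl
  | cons u d i r _ ih => simp [append, ih]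

@[simp] theorem word_append (F G : BoxForest) : (F.append G).word = F.word ++ G.word := by
  induction F with
  | nil => rfl
  | cons u d i r _ ih => simp [append, word, ih]

@[simp] theorem height_append (F G : BoxForest) :
    (F.append G).height = max F.height G.height := by
  induction F with
  | nil => simp [append, height]
  | cons u d i r _ ih => simp [append, height, ih, max_assoc]

@[simp] theorem coloured_append {η : ℕ → Bool} {F G : BoxForest} :
    (F.append G).Coloured η ↔ F.Coloured η ∧ G.Coloured η := by
  induction F with
  | nil => simp [append, Coloured]
  | cons u d i r _ ih => simp [append, Coloured, ih, and_assoc]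

theorem exists_word_eq_concat {η : ℕ → Bool} {F : BoxForest} (hF : F.Coloured η)
    (hne : F ≠ nil) : ∃ X e, F.word = X ++ [e] ∧ η e = false := by
  induction F with
  | nil => exact absurd rfl hne
  | cons u d i r _ ih =>
    by_cases hr : r = nil
    · exact ⟨u :: i.word, d, by simp [word, hr], hF.2.1⟩
    · obtain ⟨X, e, h, he⟩ := ih hF.2.2.2 hr
      exact ⟨u :: (i.word ++ d :: X), e, by simp [word, h], he⟩

theorem countP_word {η : ℕ → Bool} {F : BoxForest} (hF : F.Coloured η) :
    F.word.countP (fun i => !η i) = F.word.countP η := by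
  induction F with
  | nil => rfl
  | cons u d i r hi hr =>
    obtain ⟨hu, hd, h1, h2⟩ := hF
    simp [word, hu, hd, hi h1, hr h2]
    omega

/-! ### The position of a box in a forest -/

/-- The surroundings of a place in a forest, from the inside to the outside: an entry
`(L, u, d, R)` stands for a node with boxes `u`, `d` on the way to the place, whose siblings are the
roots of `L` (on its left) and of `R` (on its right). -/
abbrev Context := List (BoxForest × ℕ × ℕ × BoxForest)

/-- The forest obtained by putting `G` into the context. -/
def plug : Context → BoxForest → BoxForest
  | [], G => G
  | (L, u, d, R) :: C, G => plug C (L.append (cons u d G R))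

/-- The boxes to the left of the place. -/
def leftWord : Context → List ℕ
  | [] => []
  | (L, u, _, _) :: C => leftWord C ++ L.word ++ [u]

/-- The boxes to the right of the place. -/
def rightWord : Context → List ℕ
  | [] => []
  | (_, _, d, R) :: C => d :: R.word ++ rightWord C

/-- The colouring is the right one on the boxes of the context. -/
def ColouredContext (η : ℕ → Bool) : Context → Prop
  | [] => True
  | (L, u, d, R) :: C =>
    η u = true ∧ η d = false ∧ L.Coloured η ∧ R.Coloured η ∧ ColouredContext η C

theorem word_plug (C : Context) (G : BoxForest) :
    (plug C G).word = leftWord C ++ G.word ++ rightWord C := by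
  induction C generalizing G with
  | nil => simp [plug, leftWord, rightWord]
  | cons fr C ih =>
    obtain ⟨L, u, d, R⟩ := fr
    simp [plug, leftWord, rightWord, ih, word]

theorem coloured_plug {η : ℕ → Bool} {C : Context} {G : BoxForest} :
    (plug C G).Coloured η ↔ ColouredContext η C ∧ G.Coloured η := by
  induction C generalizing G with
  | nil => simp [plug, ColouredContext]
  | cons fr C ih =>
    obtain ⟨L, u, d, R⟩ := fr
    simp only [plug, ih, ColouredContext, coloured_append, Coloured]
    tauto

theorem length_add_height_le (C : Context) (G : BoxForest) :
    C.length + G.height ≤ (plug C G).height := by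
  induction C generalizing G with
  | nil => simp [plug]
  | cons fr C ih =>
    obtain ⟨L, u, d, R⟩ := fr
    have := ih (L.append (cons u d G R))
    simp only [height_append, height] at this
    simp only [plug, List.length_cons]
    omega

theorem countP_rightWord {η : ℕ → Bool} {C : Context} (hC : ColouredContext η C) :
    (rightWord C).countP (fun i => !η i) = (rightWord C).countP η + C.length := by
  induction C with
  | nil => rfl
  | cons fr C ih =>
    obtain ⟨L, u, d, R⟩ := fr
    obtain ⟨_, hd, _, hR, hC⟩ := hC
    simp [rightWord, hd, ih hC, countP_word hR]
    omega

/-- Cutting the word of a forest somewhere amounts to choosing a place in the forest. -/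
theorem exists_plug_of_word_eq {F : BoxForest} {A B : List ℕ} (h : F.word = A ++ B) :
    ∃ C L R, F = plug C (append L R) ∧ A = leftWord C ++ L.word ∧
      B = R.word ++ rightWord C := by
  induction A using List.reverseRecOn generalizing B with
  | nil => exact ⟨[], nil, F, rfl, rfl, by simpa [rightWord] using h.symm⟩
  | append_singleton A x ih =>
    obtain ⟨C, L, R, rfl, rfl, hB⟩ := ih (B := x :: B) (by simpa using h)
    cases R with
    | cons u d i r =>
      simp only [word, List.cons_append, List.cons.injEq] at hB
      obtain ⟨rfl, rfl⟩ := hB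
      exact ⟨(L, x, d, r) :: C, nil, i, rfl, by simp [leftWord, word], by simp [rightWord]⟩
    | nil =>
      match C with
      | [] => simp [word, rightWord] at hB
      | (L₀, u, d, R₀) :: C =>
        simp only [word, rightWord, List.nil_append, List.cons_append, List.cons.injEq] at hB
        obtain ⟨rfl, rfl⟩ := hB
        refine ⟨C, L₀.append (cons u x L nil), R₀, ?_, ?_, rfl⟩
        · simp [plug, append_assoc, append]
        · simp [leftWord, word]

/-- The surplus of empty boxes in an end segment of the word is the number of nodes below the
place where the segment begins. -/
theorem exists_countP_suffix {η : ℕ → Bool} {F : BoxForest} (hF : F.Coloured η) {A B : List ℕ}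
    (h : F.word = A ++ B) :
    ∃ j ≤ F.height, B.countP (fun i => !η i) = B.countP η + j ∧
      A.countP η = A.countP (fun i => !η i) + j := by
  have h0 := countP_word hF
  rw [h] at h0
  obtain ⟨C, L, R, rfl, rfl, rfl⟩ := exists_plug_of_word_eq h
  obtain ⟨hC, hG⟩ := coloured_plug.1 hF
  have h1 := countP_rightWord hC
  have h2 := countP_word (coloured_append.1 hG).2
  have h3 := length_add_height_le C (L.append R)
  refine ⟨C.length, by omega, ?_, ?_⟩ <;> simp only [List.countP_append] at * <;> omega

theorem length_le_height_of_suffix {η : ℕ → Bool} {F : BoxForest} (hF : F.Coloured η)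
    {A B : List ℕ} (h : F.word = A ++ B) (hB : ∀ i ∈ B, η i = false) : B.length ≤ F.height := by
  obtain ⟨j, hj, h1, -⟩ := exists_countP_suffix hF h
  rw [List.countP_eq_length.2 (by simpa using hB), List.countP_eq_zero.2 (by simpa using hB)] at h1
  omega

theorem length_le_height_of_prefix {η : ℕ → Bool} {F : BoxForest} (hF : F.Coloured η)
    {A B : List ℕ} (h : F.word = A ++ B) (hA : ∀ i ∈ A, η i = true) : A.length ≤ F.height := by
  obtain ⟨j, hj, -, h1⟩ := exists_countP_suffix hF h
  rw [List.countP_eq_length.2 hA, List.countP_eq_zero.2 (by simpa using hA)] at h1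
  omega

/-- A path without ramification, whose nodes carry the given pairs of boxes, from the lowest to the
highest. -/
def tower : List (ℕ × ℕ) → BoxForest
  | [] => nil
  | p :: ps => cons p.1 p.2 (tower ps) nil

@[simp] theorem height_tower (ps : List (ℕ × ℕ)) : (tower ps).height = ps.length := by
  induction ps with
  | nil => rfl
  | cons p ps ih => simp [tower, height, ih]

/-- If `k` consecutive balls are followed by `k` empty boxes, then these are the boxes of a path
of `k` nodes that ends in a leaf and has no ramification. -/
theorem exists_plug_tower {η : ℕ → Bool} {F : BoxForest} (hF : F.Coloured η)
    (ps : List (ℕ × ℕ)) (hps : ∀ p ∈ ps, η p.1 = true ∧ η p.2 = false) {A B : List ℕ}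
    (h : F.word = A ++ ps.map Prod.fst ++ (ps.map Prod.snd).reverse ++ B) :
    ∃ C L R, F = plug C (append L ((tower ps).append R)) ∧ A = leftWord C ++ L.word ∧
      B = R.word ++ rightWord C := by
  induction ps generalizing A B with
  | nil =>
    obtain ⟨C, L, R, h⟩ := exists_plug_of_word_eq (A := A) (B := B) (by simpa using h)
    exact ⟨C, L, R, h⟩
  | cons p ps ih =>
    obtain ⟨u, d⟩ := p
    obtain ⟨hu, hd⟩ := hps (u, d) (by simp)
    obtain ⟨C, L, R, rfl, hA, hB⟩ := ih (fun p hp => hps p (by simp [hp])) (A := A ++ [u])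
      (B := d :: B) (by simpa using h)
    obtain ⟨hC, hG⟩ := coloured_plug.1 hF
    simp only [coloured_append] at hG
    -- The box `u` holds a ball and `d` is empty, so no tree ends at `u` or begins at `d`.
    have hL : L = nil := by
      by_contra hne
      obtain ⟨X, e, hX, he⟩ := exists_word_eq_concat hG.1 hne
      rw [hX, ← List.append_assoc] at hA
      have := (List.append_inj' hA rfl).2
      simp_all
    have hR : R = nil := by
      cases R with
      | nil => rfl
      | cons u' d' i r =>
        simp only [word, List.cons_append, List.cons.injEq] at hB
        have := hG.2.2.1
        simp_all
    subst hL hR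
    match C with
    | [] => simp [leftWord, word] at hA
    | (L₀, u', d', R₀) :: C =>
      simp only [leftWord, word, List.append_nil] at hA
      simp only [rightWord, word, List.nil_append, List.cons_append, List.cons.injEq] at hB
      obtain ⟨h1, h2⟩ := List.append_inj' hA rfl
      obtain ⟨rfl, h3⟩ := hB
      simp only [List.cons.injEq, and_true] at h2
      exact ⟨C, L₀, R₀, by simp [plug, append, tower, h2], h1, h3⟩

/-! ### Branches -/

/-- The up-boxes of the branch that passes through the parent of the roots, above this parent,
from the lowest node of the branch to the highest one. -/
def spineUp : BoxForest → List ℕ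
  | nil => []
  | cons u _ i r => if r.height < i.height + 1 then u :: i.spineUp else r.spineUp

/-- The down-boxes of the branch that passes through the parent of the roots, above this parent,
from the highest node of the branch to the lowest one. -/
def spineDown : BoxForest → List ℕ
  | nil => []
  | cons _ d i r => if r.height < i.height + 1 then i.spineDown ++ [d] else r.spineDown

/-- The branches whose lowest nodes are in the forest, each with its up-boxes as head and its
down-boxes as tail. If `all` is true, then each root is the lowest node of a branch. Otherwise
the rightmost among the roots of largest generation number continues the branch of its parent. -/
def branches (all : Bool) : BoxForest → List Soliton
  | nil => []
  | cons u d i r =>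
    if all = false ∧ r.height < i.height + 1 then i.branches false ++ r.branches true
    else ⟨u :: i.spineUp, i.spineDown ++ [d]⟩ :: (i.branches false ++ r.branches all)

@[simp] theorem length_spineUp (F : BoxForest) : F.spineUp.length = F.height := by
  induction F with
  | nil => rfl
  | cons u d i r hi hr =>
    simp only [spineUp, height]
    split_ifs <;> simp [hi, hr] <;> omega

@[simp] theorem length_spineDown (F : BoxForest) : F.spineDown.length = F.height := by
  induction F with
  | nil => rfl
  | cons u d i r hi hr =>
    simp only [spineDown, height]
    split_ifs <;> simp [hi, hr] <;> omega

theorem spineUp_tower (ps : List (ℕ × ℕ)) : (tower ps).spineUp = ps.map Prod.fst := by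
  induction ps with
  | nil => rfl
  | cons p ps ih => simp [tower, spineUp, height, ih]

theorem spineDown_tower (ps : List (ℕ × ℕ)) :
    (tower ps).spineDown = (ps.map Prod.snd).reverse := by
  induction ps with
  | nil => rfl
  | cons p ps ih => simp [tower, spineDown, height, ih]

theorem branches_tower (ps : List (ℕ × ℕ)) : (tower ps).branches false = [] := by
  induction ps with
  | nil => rfl
  | cons p ps ih => simp [tower, branches, height, ih]

/-- `F'` arises from `F` by the removal of the branch `γ`, and the branch of the parent of the
roots is the same in both. -/
structure Prunes (F F' : BoxForest) (γ : Soliton) : Prop where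
  height_eq : F.height = F'.height
  spineUp_eq : F.spineUp = F'.spineUp
  spineDown_eq : F.spineDown = F'.spineDown
  perm : ∀ b, (F.branches b).Perm (γ :: F'.branches b)

theorem perm_branches_true_append (L : BoxForest) {G G' : BoxForest} {γ : Soliton}
    (h : (G.branches true).Perm (γ :: G'.branches true)) :
    ((L.append G).branches true).Perm (γ :: (L.append G').branches true) := by
  induction L with
  | nil => exact h
  | cons u d i r _ ih =>
    simp only [append, branches, Bool.true_eq_false, false_and, if_false]
    refine ((ih.append_left _).trans List.perm_middle |>.cons _).trans (List.Perm.swap ..)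

theorem Prunes.append_left (L : BoxForest) {G G' : BoxForest} {γ : Soliton} (h : Prunes G G' γ) :
    Prunes (L.append G) (L.append G') γ := by
  induction L with
  | nil => exact h
  | cons u d i r _ ih =>
    refine ⟨?_, ?_, ?_, fun b => ?_⟩
    · simp [append, height, h.height_eq]
    · simp [append, spineUp, ih.spineUp_eq, h.height_eq]
    · simp [append, spineDown, ih.spineDown_eq, h.height_eq]
    · simp only [append, branches, height_append, h.height_eq]
      split_ifs
      · exact ((ih.perm _).append_left _).trans List.perm_middle
      · exact (((ih.perm _).append_left _).trans List.perm_middle |>.cons _).trans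
          (List.Perm.swap ..)

theorem Prunes.cons_inner {G G' : BoxForest} {γ : Soliton} (h : Prunes G G' γ) (u d : ℕ)
    (R : BoxForest) : Prunes (cons u d G R) (cons u d G' R) γ := by
  refine ⟨?_, ?_, ?_, fun b => ?_⟩
  · simp [height, h.height_eq]
  · simp [spineUp, h.spineUp_eq, h.height_eq]
  · simp [spineDown, h.spineDown_eq, h.height_eq]
  · simp only [branches, h.height_eq, h.spineUp_eq, h.spineDown_eq]
    split_ifs
    · exact (h.perm _).append_right _
    · exact (((h.perm _).append_right _).cons _).trans (List.Perm.swap ..)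

theorem Prunes.plug (C : Context) {G G' : BoxForest} {γ : Soliton} (h : Prunes G G' γ) :
    Prunes (plug C G) (plug C G') γ := by
  induction C generalizing G G' with
  | nil => exact h
  | cons fr C ih =>
    obtain ⟨L, u, d, R⟩ := fr
    exact ih ((h.cons_inner u d R).append_left L)

/-- The boxes of a path, as a soliton. -/
def towerSoliton (ps : List (ℕ × ℕ)) : Soliton := ⟨ps.map Prod.fst, (ps.map Prod.snd).reverse⟩

theorem perm_branches_true_tower {ps : List (ℕ × ℕ)} (hps : ps ≠ []) (R : BoxForest) :
    (((tower ps).append R).branches true).Perm (towerSoliton ps :: R.branches true) := by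
  obtain ⟨p, ps, rfl⟩ := List.exists_cons_of_ne_nil hps
  simp [tower, append, branches, branches_tower, spineUp_tower, spineDown_tower, towerSoliton]

/-- A path that ends in a leaf is a branch if it has on its left a sibling of larger generation
number, or on its right one whose generation number is not smaller. -/
theorem prunes_tower {ps : List (ℕ × ℕ)} (hps : ps ≠ []) (L R : BoxForest)
    (h : ps.length < L.height ∨ ps.length ≤ R.height) :
    Prunes (L.append ((tower ps).append R)) (L.append R) (towerSoliton ps) := by
  induction L with
  | nil =>
    have hR : ps.length ≤ R.height := by simpa [height] using h
    obtain ⟨p, ps, rfl⟩ := List.exists_cons_of_ne_nil hps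
    have hR' : ¬ R.height < ps.length + 1 := by simpa using hR
    constructor
    · simp [append, tower, height]; simpa using hR
    · simp [append, tower, spineUp, hR']
    · simp [append, tower, spineDown, hR']
    · intro b
      simp [append, tower, branches, branches_tower, spineUp_tower, spineDown_tower, towerSoliton,
        hR']
  | cons u d i r _ ih =>
    by_cases h' : ps.length < r.height ∨ ps.length ≤ R.height
    · exact (ih h').append_left (cons u d i nil)
    · simp only [height] at h
      have h1 : max r.height (max ps.length R.height) < i.height + 1 := by omega
      have h2 : max r.height R.height < i.height + 1 := by omega
      constructor
      · simp [append, height]; omega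
      · simp only [append, spineUp, height_append, height_tower, if_pos h1, if_pos h2]
      · simp only [append, spineDown, height_append, height_tower, if_pos h1, if_pos h2]
      · have hp := perm_branches_true_append r (perm_branches_true_tower hps R)
        intro b
        simp only [append, branches, height_append, height_tower, h1, h2]
        cases b
        · simpa using (hp.append_left _).trans List.perm_middle
        · simpa using ((hp.append_left _).trans List.perm_middle |>.cons _).trans
            (List.Perm.swap ..)

/-- The branches of a forest are the given path and those of the rest of the forest, if the
path begins at a root or the condition of `prunes_tower` holds. -/
theorem perm_branches_plug_tower {ps : List (ℕ × ℕ)} (hps : ps ≠ []) {C : Context}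
    {L R : BoxForest} (h : C = [] ∨ ps.length < L.height ∨ ps.length ≤ R.height) :
    ((plug C (L.append ((tower ps).append R))).branches true).Perm
      (towerSoliton ps :: (plug C (L.append R)).branches true) := by
  rcases h with rfl | h
  · exact perm_branches_true_append L (perm_branches_true_tower hps R)
  · exact ((prunes_tower hps L R h).plug C).perm true

end BoxForest

/-! ### Runs and the choice of the leftmost smallest run -/

theorem exists_append_of_argmin {α : Type*} {f : α → ℕ} {l : List α} {m : α}
    (h : l.argmin f = some m) :
    ∃ P Q, l = P ++ m :: Q ∧ (∀ x ∈ P, f m < f x) ∧ ∀ x ∈ Q, f m ≤ f x := by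
  classical
  obtain ⟨hm, hmin, hfirst⟩ := List.mem_argmin_iff.1 (show m ∈ l.argmin f from h)
  obtain ⟨P, Q, rfl, hP⟩ := List.eq_append_cons_of_mem hm
  refine ⟨P, Q, rfl, fun x hx => ?_, fun x hx => hmin x (by simp [hx])⟩
  by_contra hle
  have h1 := hfirst x (by simp [hx]) (not_lt.1 hle)
  rw [List.idxOf_append_of_notMem hP, List.idxOf_append_of_mem hx] at h1
  have := List.idxOf_lt_length_of_mem hx
  omega

theorem exists_append_of_triples {α : Type*} {rs : List α} {P Q : List (α × α × α)} {a b c : α}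
    (h : triples rs = P ++ (a, b, c) :: Q) :
    ∃ X Y, rs = X ++ a :: b :: c :: Y ∧ (X = [] ∨ ∃ x X', X = X' ++ [x] ∧ (x, a, b) ∈ P) ∧
      (Y = [] ∨ ∃ y Y', Y = y :: Y' ∧ (b, c, y) ∈ Q) := by
  induction P generalizing rs with
  | nil =>
    match rs with
    | [] | [_] | [_, _] => simp [triples] at h
    | a' :: b' :: c' :: Y =>
      simp only [triples, List.nil_append, List.cons.injEq, Prod.mk.injEq] at h
      obtain ⟨⟨rfl, rfl, rfl⟩, rfl⟩ := h
      refine ⟨[], Y, rfl, Or.inl rfl, ?_⟩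
      match Y with
      | [] => exact Or.inl rfl
      | y :: Y => exact Or.inr ⟨y, Y, rfl, by simp [triples]⟩
  | cons p P ih =>
    match rs with
    | [] | [_] | [_, _] => simp [triples] at h
    | a' :: b' :: c' :: l =>
      simp only [triples, List.cons_append, List.cons.injEq] at h
      obtain ⟨rfl, h⟩ := h
      obtain ⟨X, Y, h1, h2, h3⟩ := ih h
      refine ⟨a' :: X, Y, by simp [h1], Or.inr ?_, h3⟩
      rcases h2 with rfl | ⟨x, X', rfl, hx⟩
      · simp only [List.nil_append, List.cons.injEq] at h1
        obtain ⟨rfl, rfl, rfl⟩ := h1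
        exact ⟨a', [], rfl, by simp⟩
      · exact ⟨x, a' :: X', rfl, by simp [hx]⟩

theorem exists_colour_of_mem_runs {η : ℕ → Bool} {l r : List ℕ} (h : r ∈ runs η l) :
    ∃ c, ∀ i ∈ r, η i = c := by
  have hc := List.isChain_of_mem_splitBy h
  obtain ⟨x, r, rfl⟩ := List.exists_cons_of_ne_nil (List.ne_nil_of_mem_splitBy h)
  refine ⟨η x, ?_⟩
  have hc' : List.IsChain (fun a b => η a = η b) (x :: r) := hc.imp (by simp)
  have : IsTrans ℕ fun a b => η a = η b := ⟨fun _ _ _ => Eq.trans⟩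
  have := (List.pairwise_cons.1 (List.isChain_iff_pairwise.1 hc')).1
  intro i hi
  rcases List.mem_cons.1 hi with rfl | hi
  · rfl
  · exact (this i hi).symm

theorem colour_ne_of_runs {η : ℕ → Bool} {l a b : List ℕ} {X Y : List (List ℕ)}
    (h : runs η l = X ++ a :: b :: Y) {ca cb : Bool} (ha : ∀ i ∈ a, η i = ca)
    (hb : ∀ i ∈ b, η i = cb) : ca ≠ cb := by
  have hc := List.isChain_getLast_head_splitBy (fun a b => η a == η b) l
  rw [show l.splitBy (fun a b => η a == η b) = X ++ a :: b :: Y from h] at hc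
  obtain ⟨h1, h2, h3⟩ := (List.isChain_cons_cons.1 (List.isChain_append.1 hc).2.1).1
  rw [ha _ (List.getLast_mem h1), hb _ (List.head_mem h2)] at h3
  simpa using h3

theorem triples_eq_nil {α : Type*} {rs : List α} (h : triples rs = []) :
    rs = [] ∨ (∃ a, rs = [a]) ∨ ∃ a b, rs = [a, b] := by
  match rs with
  | [] | [_] | [_, _] => simp
  | _ :: _ :: _ :: _ => simp [triples] at h

/-! ### One round of the head-tail algorithm -/

namespace BoxForest

/-- The boxes of the forest between the two records `z` and `e`. -/
def framed (z e : ℕ) (F : BoxForest) : List ℕ := z :: F.word ++ [e]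

theorem eq_nil_of_htRound {η : ℕ → Bool} {z e : ℕ} (hz : η z = false) (he : η e = false)
    {F : BoxForest} (hF : F.Coloured η) (h : htRound η (F.framed z e) = none) : F = nil := by
  simp only [htRound, Option.map_eq_none_iff, List.argmin_eq_none] at h
  have hfl : (runs η (F.framed z e)).flatten = F.framed z e := List.flatten_splitBy _ _
  have hall : ∀ i ∈ F.framed z e, η i = false := by
    rcases triples_eq_nil h with h | ⟨a, h⟩ | ⟨a, b, h⟩
    · rw [h] at hfl
      simp [framed] at hfl
    · obtain ⟨c, hc⟩ :=
        exists_colour_of_mem_runs (η := η) (l := F.framed z e) (r := a) (by simp [h])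
      rw [h] at hfl
      simp only [List.flatten_cons, List.flatten_nil, List.append_nil] at hfl
      subst hfl
      intro i hi
      rw [hc i hi, ← hc z (by simp [framed]), hz]
    · obtain ⟨c, hc⟩ :=
        exists_colour_of_mem_runs (η := η) (l := F.framed z e) (r := a) (by simp [h])
      obtain ⟨c', hc'⟩ :=
        exists_colour_of_mem_runs (η := η) (l := F.framed z e) (r := b) (by simp [h])
      have ha := List.ne_nil_of_mem_splitBy (show a ∈ runs η (F.framed z e) by simp [h])
      have hb := List.ne_nil_of_mem_splitBy (show b ∈ runs η (F.framed z e) by simp [h])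
      rw [h] at hfl
      simp only [List.flatten_cons, List.flatten_nil, List.append_nil, framed] at hfl
      obtain ⟨x, a, rfl⟩ := List.exists_cons_of_ne_nil ha
      obtain ⟨b, y, rfl⟩ := List.eq_nil_or_concat' b |>.resolve_left hb
      rw [← List.append_assoc] at hfl
      obtain ⟨h1, h2⟩ := List.append_inj' hfl rfl
      simp only [List.cons_append, List.cons.injEq, and_true] at h1 h2
      rw [h1.1] at hc
      rw [h2] at hc'
      intro i hi
      rw [framed, ← h1.2] at hi
      have hcz : c = false := by rw [← hc z (by simp), hz]
      have hce : c' = false := by rw [← hc' e (by simp), he]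
      simp only [List.mem_append, List.mem_cons, List.not_mem_nil, or_false] at hi
      rcases hi with (rfl | hi | hi) | rfl
      · exact hz
      · rw [hc i (by simp [hi]), hcz]
      · rw [hc' i (by simp [hi]), hce]
      · exact he
  cases F with
  | nil => rfl
  | cons u d i r =>
    have := hall u (by simp [framed, word])
    simp [hF.1] at this

theorem exists_eq_of_framed_eq {z e : ℕ} {F : BoxForest} {A M B : List ℕ}
    (h : F.framed z e = A ++ M ++ B) (hA : A ≠ []) (hB : B ≠ []) :
    ∃ A' B', A = z :: A' ∧ B = B' ++ [e] ∧ F.word = A' ++ M ++ B' := by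
  obtain ⟨x, A, rfl⟩ := List.exists_cons_of_ne_nil hA
  obtain ⟨B, y, rfl⟩ := List.eq_nil_or_concat' B |>.resolve_left hB
  rw [framed, ← List.append_assoc] at h
  obtain ⟨h1, h2⟩ := List.append_inj' h rfl
  simp only [List.cons_append, List.cons.injEq, and_true] at h1 h2
  exact ⟨A, B, by rw [h1.1], by rw [h2], by simpa using h1.2⟩

theorem exists_suffix_of_append_eq {η : ℕ → Bool} {Z a V w : List ℕ} {u : ℕ}
    (hu : η u = true) (ha : ∀ i ∈ a, η i = false) (h : Z ++ a = V ++ [u] ++ w) :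
    ∃ Z', w = Z' ++ a := by
  rcases List.append_eq_append_iff.1 h with ⟨c, h1, h2⟩ | ⟨c, -, h2⟩
  · rcases List.eq_nil_or_concat' c with rfl | ⟨c, y, rfl⟩
    · exact ⟨[], by simpa using h2.symm⟩
    · rw [← List.append_assoc] at h1
      have h3 := (List.append_inj' h1 rfl).2
      have := ha y (by simp [h2])
      simp_all
  · exact ⟨c, h2⟩

theorem exists_prefix_of_append_eq {η : ℕ → Bool} {Z c V w : List ℕ} {d : ℕ}
    (hd : η d = false) (hc : ∀ i ∈ c, η i = true) (h : c ++ Z = w ++ d :: V) :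
    ∃ Z', w = c ++ Z' := by
  rcases List.append_eq_append_iff.1 h with ⟨c', h1, -⟩ | ⟨c', h1, h2⟩
  · exact ⟨c', h1⟩
  · cases c' with
    | nil => exact ⟨[], by simpa using h1.symm⟩
    | cons y c' =>
      simp only [List.cons_append, List.cons.injEq] at h2
      have := hc y (by simp [h1])
      simp_all

/-- What a round of the algorithm finds: `k` balls in the boxes `us` followed by the `k` empty boxes
`ds`. Either the next run to the left of `us` is infinite or has more than `k` boxes,
or the next run to the right of `ds` is finite and has at least `k` boxes. -/
theorem exists_of_htRound {η : ℕ → Bool} {z e : ℕ} (hz : η z = false) (he : η e = false)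
    {F : BoxForest} (hF : F.Coloured η) {γ : Soliton}
    (h : htRound η (F.framed z e) = some γ) :
    ∃ A us ds B, γ = ⟨us, ds⟩ ∧ us ≠ [] ∧ us.length = ds.length ∧ (∀ i ∈ us, η i = true) ∧
      (∀ i ∈ ds, η i = false) ∧ F.word = A ++ us ++ ds ++ B ∧
      ((∀ i ∈ A, η i = false) ∨
        (∃ A' a, A = A' ++ a ∧ (∀ i ∈ a, η i = false) ∧ us.length < a.length) ∨
        ∃ c B', B = c ++ B' ∧ (∀ i ∈ c, η i = true) ∧ us.length ≤ c.length) := by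
  simp only [htRound, Option.map_eq_some_iff] at h
  obtain ⟨⟨a, b, c⟩, hmin, hγ⟩ := h
  obtain ⟨P, Q, hPQ, hP, hQ⟩ := exists_append_of_argmin hmin
  obtain ⟨X, Y, hXY, hX, hY⟩ := exists_append_of_triples hPQ
  have hfl : (runs η (F.framed z e)).flatten = F.framed z e := List.flatten_splitBy _ _
  have hmem : ∀ r ∈ X ++ a :: b :: c :: Y, r ≠ [] := fun r hr =>
    List.ne_nil_of_mem_splitBy (show r ∈ runs η (F.framed z e) by rwa [hXY])
  have hcol : ∀ r ∈ X ++ a :: b :: c :: Y, ∃ c, ∀ i ∈ r, η i = c := fun r hr =>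
    exists_colour_of_mem_runs (show r ∈ runs η (F.framed z e) by rwa [hXY])
  obtain ⟨ca, hca⟩ := hcol a (by simp)
  obtain ⟨cb, hcb⟩ := hcol b (by simp)
  obtain ⟨cc, hcc⟩ := hcol c (by simp)
  have hab := colour_ne_of_runs hXY hca hcb
  have hbc := colour_ne_of_runs (X := X ++ [a]) (by simpa using hXY) hcb hcc
  have ha0 := hmem a (by simp)
  have hb0 := hmem b (by simp)
  have hc0 := hmem c (by simp)
  have hXf : X ≠ [] → X.flatten ≠ [] := by
    intro hne h0
    obtain ⟨x, X, rfl⟩ := List.exists_cons_of_ne_nil hne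
    exact hmem x (by simp) (List.flatten_eq_nil_iff.1 h0 x (by simp))
  have hYf : Y ≠ [] → Y.flatten ≠ [] := by
    intro hne h0
    obtain ⟨y, Y, rfl⟩ := List.exists_cons_of_ne_nil hne
    exact hmem y (by simp) (List.flatten_eq_nil_iff.1 h0 y (by simp))
  rw [hXY] at hfl
  simp only [List.flatten_append, List.flatten_cons] at hfl
  have hXlt : X ≠ [] → b.length < a.length := by
    intro hne
    obtain ⟨x, X', -, hx⟩ := hX.resolve_left hne
    exact hP _ hx
  have hYle : Y ≠ [] → b.length ≤ c.length := by
    intro hne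
    obtain ⟨y, Y', -, hy⟩ := hY.resolve_left hne
    exact hQ _ hy
  cases cb with
  | true =>
    obtain rfl : ca = false := by simpa using hab
    obtain rfl : cc = false := by simpa using hbc.symm
    have hall : b.all η = true := by simpa using hcb
    simp only [hall, if_true] at hγ
    -- If `c` is the last visible run, then it has more than `k` boxes, since it contains `e`, and
    -- no end segment of the excursion has more balls than empty boxes.
    have hk : b.length ≤ c.length ∧ c.drop b.length ++ Y.flatten ≠ [] := by
      by_cases hY0 : Y = []
      · subst hY0
        obtain ⟨c, y, rfl⟩ := List.eq_nil_or_concat' c |>.resolve_left hc0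
        have hle : b.length ≤ c.length := by
          obtain ⟨A', B', hA', hB', hw⟩ := exists_eq_of_framed_eq (A := X.flatten ++ a)
            (M := b ++ c) (B := [y]) (by rw [← hfl]; simp) (by simp [ha0]) (by simp)
          obtain rfl : B' = [] := by
            have := congrArg List.length hB'
            simpa using this
          obtain ⟨j, -, hj, -⟩ := exists_countP_suffix hF (A := A') (B := b ++ c)
            (by simpa using hw)
          simp only [List.countP_append] at hj
          rw [List.countP_eq_length.2 hcb, List.countP_eq_zero.2 (by simpa using hcb),
            List.countP_eq_length.2 (by intro i hi; simp [hcc i (by simp [hi])]),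
            List.countP_eq_zero.2 (by intro i hi; simp [hcc i (by simp [hi])])] at hj
          omega
        refine ⟨by simp; omega, ?_⟩
        intro h0
        have := congrArg List.length h0
        simp at this
        omega
      · exact ⟨hYle hY0, by simp [hYf hY0]⟩
    obtain ⟨A', B', hA', hB', hw⟩ := exists_eq_of_framed_eq (A := X.flatten ++ a)
      (M := b ++ c.take b.length) (B := c.drop b.length ++ Y.flatten)
      (by rw [← hfl]; simp only [List.append_assoc, List.append_cancel_left_eq]
          rw [← List.append_assoc, List.take_append_drop]) (by simp [ha0]) hk.2
    refine ⟨A', b, c.take b.length, B', hγ.symm, hb0, by simp [hk.1], hcb,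
      fun i hi => hcc i (List.mem_of_mem_take hi), by simpa using hw, ?_⟩
    by_cases hX0 : X = []
    · left
      intro i hi
      exact hca i (by simp [hX0] at hA'; simp [hA', hi])
    · right; left
      obtain ⟨x, X', hX'⟩ := List.exists_cons_of_ne_nil (hXf hX0)
      rw [hX'] at hA'
      simp only [List.cons_append, List.cons.injEq] at hA'
      exact ⟨X', a, hA'.2.symm, hca, hXlt hX0⟩
  | false =>
    obtain rfl : ca = true := by simpa using hab
    obtain rfl : cc = true := by simpa using hbc.symm
    have hall : ¬ b.all η = true := by
      obtain ⟨x, b, rfl⟩ := List.exists_cons_of_ne_nil hb0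
      simp [hcb x (by simp)]
    rw [if_neg hall] at hγ
    -- The neighbouring runs are occupied, so they contain neither of the records.
    have hX0 : X ≠ [] := by
      rintro rfl
      obtain ⟨x, a, rfl⟩ := List.exists_cons_of_ne_nil ha0
      simp only [framed, List.flatten_nil, List.nil_append, List.cons_append,
        List.cons.injEq] at hfl
      have := hca x (by simp)
      simp_all
    have hY0 : Y ≠ [] := by
      rintro rfl
      obtain ⟨c, y, rfl⟩ := List.eq_nil_or_concat' c |>.resolve_left hc0
      simp only [framed, List.flatten_nil, List.append_nil, ← List.append_assoc] at hfl
      have h2 := (List.append_inj' hfl rfl).2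
      have := hcc y (by simp)
      simp_all
    have hlt := hXlt hX0
    have hle := hYle hY0
    obtain ⟨A', B', hA', hB', hw⟩ := exists_eq_of_framed_eq (A := X.flatten ++ a.rdrop b.length)
      (M := a.rtake b.length ++ b) (B := c ++ Y.flatten)
      (by rw [← hfl]; simp only [List.append_assoc, List.append_cancel_left_eq, List.rdrop,
            List.rtake]
          rw [← List.append_assoc (List.take _ _), List.take_append_drop])
      (by simp [hXf hX0]) (by simp [hc0])
    refine ⟨A', a.rtake b.length, b, B', hγ.symm, ?_, ?_,
      fun i hi => hca i (List.mem_of_mem_drop hi), hcb, by simpa using hw, Or.inr (Or.inr ?_)⟩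
    · intro h0
      have h1 := congrArg List.length h0
      have h2 := List.length_pos_iff.2 hb0
      simp [List.rtake] at h1
      omega
    · simp [List.rtake]; omega
    · obtain ⟨Y', y, hY'⟩ := List.eq_nil_or_concat' Y.flatten |>.resolve_left (hYf hY0)
      rw [hY', ← List.append_assoc] at hB'
      refine ⟨c, Y', ((List.append_inj' hB' rfl).1).symm, hcc, ?_⟩
      simp [List.rtake]; omega

/-- A round of the algorithm finds a branch of the forest, and the removal of its boxes amounts
to the removal of this branch from the forest. -/
theorem exists_prune_of_htRound {η : ℕ → Bool} {z e : ℕ} (hz : η z = false) (he : η e = false)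
    {F : BoxForest} (hF : F.Coloured η) (hnd : (F.framed z e).Nodup) {γ : Soliton}
    (h : htRound η (F.framed z e) = some γ) :
    ∃ F' : BoxForest, F'.Coloured η ∧
      (F.framed z e).filter (fun i => i ∉ γ.boxes) = F'.framed z e ∧
      (F.branches true).Perm (γ :: F'.branches true) := by
  obtain ⟨A, us, ds, B, rfl, hus, hlen, hu, hd, hw, hcond⟩ := exists_of_htRound hz he hF h
  have hm1 : (us.zip ds.reverse).map Prod.fst = us := List.map_fst_zip (by simp [hlen])
  have hm2 : ((us.zip ds.reverse).map Prod.snd).reverse = ds := by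
    rw [List.map_snd_zip (by simp [hlen]), List.reverse_reverse]
  have hps : us.zip ds.reverse ≠ [] := by
    intro h0
    rw [h0] at hm1
    exact hus hm1.symm
  have hpl : (us.zip ds.reverse).length = us.length := by simp [hlen]
  obtain ⟨C, L, R, rfl, rfl, rfl⟩ := exists_plug_tower hF (us.zip ds.reverse)
    (fun p hp => ⟨hu _ (List.of_mem_zip (a := p.1) (b := p.2) hp).1,
      hd _ (by simpa using (List.of_mem_zip (a := p.1) (b := p.2) hp).2)⟩)
    (A := A) (B := B) (by rw [hm1, hm2, hw])
  obtain ⟨hC, hG⟩ := coloured_plug.1 hF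
  simp only [coloured_append] at hG
  have hword : (plug C (L.append R)).word = leftWord C ++ L.word ++ (R.word ++ rightWord C) := by
    simp [word_plug]
  refine ⟨plug C (L.append R), coloured_plug.2 ⟨hC, coloured_append.2 ⟨hG.1, hG.2.2⟩⟩, ?_, ?_⟩
  · simp only [framed, hw, hword, Soliton.boxes] at hnd ⊢
    generalize leftWord C ++ L.word = A at *
    generalize R.word ++ rightWord C = B at *
    simp only [List.cons_append, List.append_assoc, List.nodup_cons, List.nodup_append,
      List.mem_append, not_or] at hnd
    have hfil : ∀ p : ℕ → Bool, (∀ i, p i = true ↔ i ∉ us ∧ i ∉ ds) →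
        (z :: (A ++ (us ++ (ds ++ (B ++ [e]))))).filter p = z :: (A ++ (B ++ [e])) := by
      intro p hp
      have hA : A.filter p = A := List.filter_eq_self.2 fun i hi => by rw [hp]; grind
      have hB : (B ++ [e]).filter p = B ++ [e] :=
        List.filter_eq_self.2 fun i hi => by rw [hp]; grind
      have hus' : us.filter p = [] := List.filter_eq_nil_iff.2 fun i hi => by simp [hp, hi]
      have hds' : ds.filter p = [] := List.filter_eq_nil_iff.2 fun i hi => by simp [hp, hi]
      rw [List.filter_cons_of_pos ((hp z).2 ⟨hnd.1.2.1, hnd.1.2.2.1⟩), List.filter_append,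
        List.filter_append, List.filter_append, hA, hB, hus', hds']
      rfl
    simpa using hfil (fun i => i ∉ us ++ ds) (by simp)
  · have := perm_branches_plug_tower hps (C := C) (L := L) (R := R) ?_
    · rwa [towerSoliton, hm1, hm2] at this
    · rw [hpl]
      match C with
      | [] => exact Or.inl rfl
      | (L₀, u, d, R₀) :: C =>
        right
        have hu' : η u = true := hC.1
        have hd' : η d = false := hC.2.1
        rcases hcond with hcond | ⟨A', a, hA, ha, hlt⟩ | ⟨c, B', hB, hc, hle⟩
        · have := hcond u (by simp [leftWord])
          simp [hu'] at this
        · obtain ⟨Z, hZ⟩ := exists_suffix_of_append_eq hu' ha (V := leftWord C ++ L₀.word)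
            (w := L.word) (Z := A') (by rw [← hA]; rfl)
          exact Or.inl (hlt.trans_le (length_le_height_of_suffix hG.1 hZ ha))
        · obtain ⟨Z, hZ⟩ := exists_prefix_of_append_eq hd' hc (V := R₀.word ++ rightWord C)
            (w := R.word) (Z := B') (by rw [← hB]; simp [rightWord])
          exact Or.inr (hle.trans (length_le_height_of_prefix hG.2.2 hZ hc))

/-- The solitons of the head-tail decomposition are the branches, with the same boxes. -/
theorem perm_htLoop_branches {η : ℕ → Bool} {z e : ℕ} (hz : η z = false) (he : η e = false)
    (r : ℕ) {F : BoxForest} (hF : F.Coloured η) (hnd : (F.framed z e).Nodup)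
    (hr : (F.branches true).length ≤ r) :
    (htLoop η r (F.framed z e)).Perm (F.branches true) := by
  induction r generalizing F with
  | zero =>
    rw [List.length_eq_zero_iff.1 (Nat.le_zero.1 hr)]
    rfl
  | succ r ih =>
    unfold htLoop
    split
    · next h => rw [eq_nil_of_htRound hz he hF h]; rfl
    · next γ h =>
      obtain ⟨F', hF', hfil, hperm⟩ := exists_prune_of_htRound hz he hF hnd h
      rw [hfil]
      refine ((ih hF' ?_ ?_).cons _).trans hperm.symm
      · rw [← hfil]; exact hnd.filter _
      · have := hperm.length_eq
        simp only [List.length_cons] at this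
        omega

end BoxForest

/-! ### Counting markers between separators -/

/-- Read a list of separators (`true`) and markers (`false`) from left to right. The result lists
the numbers of markers before the first separator, between consecutive separators and after
the last one, where the first number is increased by `a`. -/
def counts (a : ℕ) : List Bool → List ℕ
  | [] => [a]
  | true :: l => a :: counts 0 l
  | false :: l => counts (a + 1) l

theorem counts_append_true (a : ℕ) (l l' : List Bool) :
    counts a (l ++ true :: l') = counts a l ++ counts 0 l' := by
  induction l generalizing a with
  | nil => rfl
  | cons b l ih => cases b <;> simp [counts, ih]

theorem length_counts (a : ℕ) (l : List Bool) : (counts a l).length = 1 + l.count true := by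
  induction l generalizing a with
  | nil => rfl
  | cons b l ih => cases b <;> simp [counts, ih]; omega

theorem sum_counts (a : ℕ) (l : List Bool) : (counts a l).sum = a + l.count false := by
  induction l generalizing a with
  | nil => rfl
  | cons b l ih => cases b <;> simp [counts, ih]; omega

/-- The positions of the separators in a list of positions with separators and markers. -/
def separators (m : List (ℕ × Bool)) : List ℕ := (m.filter fun q => q.2).map Prod.fst

theorem mem_separators {m : List (ℕ × Bool)} {p : ℕ} : p ∈ separators m ↔ (p, true) ∈ m := by
  simp [separators]

/-- If `f` counts the markers strictly between two positions, with `c` additional ones after `a`,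
then its values at consecutive separators are the list `counts`. -/
theorem zipWith_separators (f : ℕ → ℕ → ℕ) (b : ℕ) (m : List (ℕ × Bool)) (a c : ℕ)
    (hm : (m.map Prod.fst).Pairwise (· < ·)) (hb : ∀ q ∈ m, q.1 < b)
    (hfa : ∀ y ∈ separators m ++ [b], f a y = c + m.countP fun q => !q.2 ∧ q.1 < y)
    (hf : ∀ x ∈ separators m, ∀ y ∈ separators m ++ [b],
      f x y = m.countP fun q => !q.2 ∧ x < q.1 ∧ q.1 < y) :
    List.zipWith f (a :: separators m) (separators m ++ [b]) = counts c (m.map Prod.snd) := by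
  induction m generalizing a c with
  | nil => simpa [separators, counts] using hfa b (by simp)
  | cons q m ih =>
    obtain ⟨p, t⟩ := q
    simp only [List.map_cons, List.pairwise_cons, List.mem_map, forall_exists_index, and_imp,
      forall_apply_eq_imp_iff₂] at hm
    have hsep : ∀ x ∈ separators m, p < x := fun x hx => hm.1 (x, true) (mem_separators.1 hx)
    have hb' : ∀ q ∈ m, q.1 < b := fun q hq => hb q (by simp [hq])
    cases t with
    | true =>
      have hs : separators ((p, true) :: m) = p :: separators m := by simp [separators]
      rw [hs] at hfa hf ⊢
      simp only [List.cons_append, List.zipWith_cons_cons, List.map_cons, counts]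
      congr 1
      · rw [hfa p (by simp), List.countP_eq_zero.2, Nat.add_zero]
        intro q hq
        rcases List.mem_cons.1 hq with rfl | hq
        · simp
        · have := hm.1 q hq
          simp; omega
      · refine ih p 0 hm.2 hb' ?_ ?_
        · intro y hy
          rw [hf p (by simp) y (by simp at hy ⊢; tauto), Nat.zero_add, List.countP_cons_of_neg
            (by simp)]
          refine List.countP_congr fun q hq => ?_
          have := hm.1 q hq
          simp [this]
        · intro x hx y hy
          rw [hf x (by simp [hx]) y (by simp at hy ⊢; tauto), List.countP_cons_of_neg (by simp)]
    | false =>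
      have hs : separators ((p, false) :: m) = separators m := by simp [separators]
      rw [hs] at hfa hf ⊢
      simp only [List.map_cons, counts]
      refine ih a (c + 1) hm.2 hb' ?_ ?_
      · intro y hy
        have hpy : p < y := by
          rcases List.mem_append.1 hy with hy | hy
          · exact hsep y hy
          · obtain rfl := List.mem_singleton.1 hy
            exact hb (p, false) (by simp)
        rw [hfa y hy, List.countP_cons_of_pos (by simpa using hpy)]
        omega
      · intro x hx y hy
        have := hsep x hx
        rw [hf x hx y hy, List.countP_cons_of_neg (by simp; omega)]

namespace BoxForest

/-! ### Slots and branches in the word of a forest -/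

/-- The boxes of the nodes of generation number larger than `k` (marked by `true`), which
are the `k`-slots, and the up-boxes of the lowest nodes of the branches of size `k` (marked
by `false`), from left to right. The flag `all` has the same meaning as for `branches`. -/
def marks (k : ℕ) (all : Bool) : BoxForest → List (ℕ × Bool)
  | nil => []
  | cons u d i r =>
    if k < i.height + 1 then
      (u, true) :: (i.marks k false ++
        (d, true) :: r.marks k (all || decide (r.height < i.height + 1)))
    else if all = false ∧ r.height < i.height + 1 then r.marks k true
    else if i.height + 1 = k then (u, false) :: r.marks k all
    else r.marks k all

theorem marks_sublist_word (k : ℕ) (all : Bool) (F : BoxForest) :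
    ((F.marks k all).map Prod.fst).Sublist F.word := by
  induction F generalizing all with
  | nil => simp [marks, word]
  | cons u d i r hi hr =>
    simp only [marks, word]
    have hr' : ∀ b, ((r.marks k b).map Prod.fst).Sublist (i.word ++ d :: r.word) := fun b =>
      ((hr b).cons d).trans (List.sublist_append_right _ _)
    split_ifs
    · simpa using (hi false).append ((hr _).cons_cons d)
    · exact (hr' _).cons u
    · exact (hr' _).cons_cons u
    · exact (hr' _).cons u

theorem marks_eq_nil {k : ℕ} {all : Bool} {F : BoxForest} (h : F.height < k) :
    F.marks k all = [] := by
  induction F generalizing all with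
  | nil => rfl
  | cons u d i r _ hr =>
    simp only [height, max_lt_iff] at h
    simp only [marks]
    split_ifs
    · omega
    · exact hr h.2
    · omega
    · exact hr h.2

theorem size_le_height {all : Bool} {F : BoxForest} {γ : Soliton} (h : γ ∈ F.branches all) :
    γ.size ≤ F.height := by
  induction F generalizing all with
  | nil => simp [branches] at h
  | cons u d i r hi hr =>
    simp only [height]
    simp only [branches] at h
    split_ifs at h
    · rcases List.mem_append.1 h with h | h
      · have := hi h; omega
      · have := hr h; omega
    · rcases List.mem_cons.1 h with rfl | h
      · simp [Soliton.size]
      · rcases List.mem_append.1 h with h | h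
        · have := hi h; omega
        · have := hr h; omega

theorem mem_word_of_mem_spineUp {F : BoxForest} {p : ℕ} (h : p ∈ F.spineUp) : p ∈ F.word := by
  induction F with
  | nil => simp [spineUp] at h
  | cons u d i r hi hr =>
    simp only [spineUp] at h
    simp only [word]
    split_ifs at h
    · rcases List.mem_cons.1 h with rfl | h
      · simp
      · simp [hi h]
    · simp [hr h]

theorem mem_word_of_mem_spineDown {F : BoxForest} {p : ℕ} (h : p ∈ F.spineDown) :
    p ∈ F.word := by
  induction F with
  | nil => simp [spineDown] at h
  | cons u d i r hi hr =>
    simp only [spineDown] at h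
    simp only [word]
    split_ifs at h
    · rcases List.mem_append.1 h with h | h
      · simp [hi h]
      · simp_all
    · simp [hr h]

theorem mem_word_of_mem_boxes {all : Bool} {F : BoxForest} {γ : Soliton}
    (h : γ ∈ F.branches all) {p : ℕ} (hp : p ∈ γ.boxes) : p ∈ F.word := by
  induction F generalizing all with
  | nil => simp [branches] at h
  | cons u d i r hi hr =>
    simp only [branches] at h
    simp only [word, List.mem_cons, List.mem_append]
    split_ifs at h
    · rcases List.mem_append.1 h with h | h
      · exact Or.inr (Or.inl (hi h))
      · exact Or.inr (Or.inr (Or.inr (hr h)))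
    · rcases List.mem_cons.1 h with rfl | h
      · simp only [Soliton.boxes, List.mem_append, List.mem_cons, List.not_mem_nil,
          or_false] at hp
        rcases hp with (hp | hp) | hp | hp
        · exact Or.inl hp
        · exact Or.inr (Or.inl (mem_word_of_mem_spineUp hp))
        · exact Or.inr (Or.inl (mem_word_of_mem_spineDown hp))
        · exact Or.inr (Or.inr (Or.inl hp))
      · rcases List.mem_append.1 h with h | h
        · exact Or.inr (Or.inl (hi h))
        · exact Or.inr (Or.inr (Or.inr (hr h)))

/-- The box `p` is one of the `k`-slots that the soliton contributes: one of the `m - k` first boxes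
of its head or of the `m - k` last boxes of its tail, where `m > k` is its size. -/
def _root_.BoxBall.Soliton.HasSlot (γ : Soliton) (k p : ℕ) : Prop :=
  k < γ.size ∧ (p ∈ γ.head.take (γ.size - k) ∨ p ∈ γ.tail.drop k)

/-- The slots in the sense of the head-tail decomposition are the boxes of the nodes of generation
number larger than `k`: in a branch of size `m`, the node number `ℓ` from below has generation
number `m + 1 - ℓ`. -/
theorem mem_marks_iff {k : ℕ} {all : Bool} {F : BoxForest} {p : ℕ} :
    (p, true) ∈ F.marks k all ↔
      (∃ γ ∈ F.branches all, γ.HasSlot k p) ∨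
        (all = false ∧ (p ∈ F.spineUp.take (F.height - k) ∨ p ∈ F.spineDown.drop k)) := by
  induction F generalizing all with
  | nil => simp [marks, branches, spineUp, spineDown]
  | cons u d i r hi hr =>
    by_cases hk : k < i.height + 1
    · have hup : (u :: i.spineUp).take (i.height + 1 - k) =
          u :: i.spineUp.take (i.height - k) := by
        rw [show i.height + 1 - k = (i.height - k) + 1 by omega, List.take_succ_cons]
      have hdown : (i.spineDown ++ [d]).drop k = i.spineDown.drop k ++ [d] :=
        List.drop_append_of_le_length (by simp; omega)
      by_cases hc : all = false ∧ r.height < i.height + 1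
      · obtain ⟨rfl, hc⟩ := hc
        have hmax : max (i.height + 1) r.height = i.height + 1 := by omega
        simp only [marks, branches, spineUp, spineDown, height, hmax, if_pos hk, hc, and_self,
          if_true, hup, hdown, List.mem_cons, List.mem_append, hi, hr, Prod.mk.injEq, or_and_right,
          exists_or, List.not_mem_nil, decide_true, Bool.or_true]
        generalize (∃ γ ∈ i.branches false, γ.HasSlot k p) = P
        generalize (∃ γ ∈ r.branches true, γ.HasSlot k p) = Q
        clear hi hr
        grind
      · have hall : (all || decide (r.height < i.height + 1)) = all := by
          cases all <;> simp_all
        have hown : (⟨u :: i.spineUp, i.spineDown ++ [d]⟩ : Soliton).HasSlot k p ↔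
            (p = u ∨ p ∈ i.spineUp.take (i.height - k)) ∨ p ∈ i.spineDown.drop k ∨ p = d := by
          simp only [Soliton.HasSlot, Soliton.size, List.length_cons, length_spineUp, hk, hup,
            hdown, true_and, List.mem_cons, List.mem_append, List.not_mem_nil, or_false]
        have hsp : (all = false ∧ (p ∈ (cons u d i r).spineUp.take ((cons u d i r).height - k) ∨
              p ∈ (cons u d i r).spineDown.drop k)) ↔
            (all = false ∧ (p ∈ r.spineUp.take (r.height - k) ∨ p ∈ r.spineDown.drop k)) := by
          refine and_congr_right ?_
          rintro rfl
          have hc : ¬ r.height < i.height + 1 := by simpa using hc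
          have hmax : max (i.height + 1) r.height = r.height := by omega
          simp only [spineUp, spineDown, hc, if_false, height, hmax]
        rw [hsp]
        simp only [marks, branches, if_pos hk, if_neg hc, List.mem_cons, List.mem_append, hi, hr,
          or_and_right, exists_or, exists_eq_left, hall, hown, Prod.mk.injEq, and_true]
        generalize (∃ γ ∈ i.branches false, γ.HasSlot k p) = P
        generalize (∃ γ ∈ r.branches all, γ.HasSlot k p) = Q
        clear hi hr hown hsp
        grind
    · have hsize : ¬ ∃ γ ∈ i.branches false, γ.HasSlot k p := by
        rintro ⟨γ, hγ, h, -⟩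
        have := size_le_height hγ
        omega
      by_cases hc : all = false ∧ r.height < i.height + 1
      · obtain ⟨rfl, hc⟩ := hc
        have hmax : max (i.height + 1) r.height = i.height + 1 := by omega
        have h1 : i.height + 1 - k = 0 := by omega
        have h2 : (i.spineDown ++ [d]).drop k = [] := List.drop_of_length_le (by simp; omega)
        simp only [marks, branches, spineUp, spineDown, height, hmax, if_neg hk, hc, and_self,
          if_true, h1, h2, List.take_zero, List.mem_append, or_and_right, exists_or, hr, hsize]
        simp
      · have hlhs : (p, true) ∈ (cons u d i r).marks k all ↔ (p, true) ∈ r.marks k all := by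
          simp only [marks, if_neg hk, if_neg hc]
          split_ifs <;> simp
        have hown : ¬ (⟨u :: i.spineUp, i.spineDown ++ [d]⟩ : Soliton).HasSlot k p := by
          rintro ⟨h, -⟩
          simp only [Soliton.size, List.length_cons, length_spineUp] at h
          exact hk h
        rw [hlhs, hr]
        simp only [branches, if_neg hc, List.mem_cons, List.mem_append,
          or_and_right, exists_or, exists_eq_left, hown, hsize, false_or]
        refine or_congr_right (and_congr_right ?_)
        rintro rfl
        have hc : ¬ r.height < i.height + 1 := by simpa using hc
        have hmax : max (i.height + 1) r.height = r.height := by omega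
        simp only [spineUp, spineDown, hc, if_false, height, hmax]

/-- The first box of a soliton. -/
def _root_.BoxBall.Soliton.first (γ : Soliton) : ℕ := γ.head.headD 0

theorem map_first_filter_branches (k : ℕ) (all : Bool) (F : BoxForest) :
    ((F.branches all).filter fun γ => γ.size = k).map Soliton.first =
      ((F.marks k all).filter fun q => !q.2).map Prod.fst := by
  induction F generalizing all with
  | nil => rfl
  | cons u d i r hi hr =>
    by_cases hk : k < i.height + 1
    · have hne : i.height + 1 ≠ k := by omega
      by_cases hc : all = false ∧ r.height < i.height + 1
      · simp [marks, branches, hk, hc, hi, hr]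
      · have hall : (all || decide (r.height < i.height + 1)) = all := by
          cases all <;> simp_all
        simp only [marks, branches, if_pos hk, if_neg hc, hall]
        rw [List.filter_cons_of_neg (by simp [Soliton.size, hne])]
        simp [hi, hr]
    · have hi0 : (i.branches false).filter (fun γ => γ.size = k) = [] := by
        rw [List.filter_eq_nil_iff]
        intro γ hγ
        have := size_le_height hγ
        simp; omega
      by_cases hc : all = false ∧ r.height < i.height + 1
      · simp [marks, branches, hk, hc, hi0, hr]
      · by_cases hne : i.height + 1 = k
        · simp only [marks, branches, if_neg hk, if_neg hc, if_pos hne]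
          rw [List.filter_cons_of_pos (by simp [Soliton.size, hne])]
          simp [hi0, hr, Soliton.first]
        · simp only [marks, branches, if_neg hk, if_neg hc, if_neg hne]
          rw [List.filter_cons_of_neg (by simp [Soliton.size, hne])]
          simp [hi0, hr]

theorem pairwise_word_cons {u d : ℕ} {i r : BoxForest}
    (h : (cons u d i r).word.Pairwise (· < ·)) :
    (∀ p ∈ i.word, u < p) ∧ (∀ p ∈ r.word, d < p) ∧ (∀ p ∈ i.word, p < d) ∧ u < d ∧
      i.word.Pairwise (· < ·) ∧ r.word.Pairwise (· < ·) := by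
  simp only [word, List.pairwise_cons, List.pairwise_append, List.mem_append, List.mem_cons] at h
  obtain ⟨h1, h2, h3, h4⟩ := h
  exact ⟨fun p hp => h1 p (Or.inl hp), h3.1, fun p hp => h4 p hp d (Or.inl rfl),
    h1 d (Or.inr (Or.inl rfl)), h2, h3.2⟩

theorem first_mem_boxes {all : Bool} {F : BoxForest} {γ : Soliton} (h : γ ∈ F.branches all) :
    γ.first ∈ γ.boxes := by
  induction F generalizing all with
  | nil => simp [branches] at h
  | cons u d i r hi hr =>
    simp only [branches] at h
    split_ifs at h
    · rcases List.mem_append.1 h with h | h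
      · exact hi h
      · exact hr h
    · rcases List.mem_cons.1 h with rfl | h
      · simp [Soliton.first, Soliton.boxes]
      · rcases List.mem_append.1 h with h | h
        · exact hi h
        · exact hr h

/-- The boxes of a branch, other than its first box, are to the right of the first box, and a
slot to the right of the first box of a branch of size `k` is to the right of all its boxes. -/
theorem boxes_of_mem_branches {k : ℕ} {all : Bool} {F : BoxForest}
    (hF : F.word.Pairwise (· < ·)) {γ : Soliton} (hγ : γ ∈ F.branches all) {p : ℕ}
    (hp : p ∈ γ.boxes) :
    γ.first ≤ p ∧ (γ.size = k → ∀ s, (s, true) ∈ F.marks k all → γ.first < s → p < s) := by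
  induction F generalizing all with
  | nil => simp [branches] at hγ
  | cons u d i r hi hr =>
    obtain ⟨h1, h2, h3, h4, h5, h6⟩ := pairwise_word_cons hF
    have hmem : ∀ {b : Bool} {G : BoxForest} {s : ℕ}, (s, true) ∈ G.marks k b → s ∈ G.word :=
      fun h => (marks_sublist_word k _ _).subset (List.mem_map_of_mem h)
    have hins : γ ∈ i.branches false → γ.first ≤ p ∧ (γ.size = k → ∀ s,
        (s, true) ∈ (cons u d i r).marks k all → γ.first < s → p < s) := by
      intro h
      refine ⟨(hi h5 h).1, fun hk s hs hlt => ?_⟩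
      have hsz := size_le_height h
      have hpd := h3 p (mem_word_of_mem_boxes h hp)
      have huf := h1 _ (mem_word_of_mem_boxes h (first_mem_boxes h))
      simp only [marks, if_pos (show k < i.height + 1 by omega), List.mem_cons, List.mem_append,
        Prod.mk.injEq, and_true] at hs
      rcases hs with rfl | hs | rfl | hs
      · omega
      · exact (hi h5 h).2 hk s hs hlt
      · exact hpd
      · exact hpd.trans (h2 s (hmem hs))
    have hrest : ∀ b, γ ∈ r.branches b → (∀ s, (s, true) ∈ (cons u d i r).marks k all →
        s ≤ d ∨ (s, true) ∈ r.marks k b) → γ.first ≤ p ∧ (γ.size = k → ∀ s,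
        (s, true) ∈ (cons u d i r).marks k all → γ.first < s → p < s) := by
      intro b h hb
      refine ⟨(hr h6 h).1, fun hk s hs hlt => ?_⟩
      have hdf := h2 _ (mem_word_of_mem_boxes h (first_mem_boxes h))
      rcases hb s hs with hs | hs
      · omega
      · exact (hr h6 h).2 hk s hs hlt
    have hle : ∀ {s}, (s, true) ∈ i.marks k false → s ≤ d := fun hs => (h3 _ (hmem hs)).le
    simp only [branches] at hγ
    split_ifs at hγ with hc
    · rcases List.mem_append.1 hγ with h | h
      · exact hins h
      · refine hrest _ h fun s hs => ?_
        simp only [marks, hc, and_self, if_true, decide_true, Bool.or_true] at hs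
        split_ifs at hs
        · simp only [List.mem_cons, List.mem_append, Prod.mk.injEq, and_true] at hs
          rcases hs with rfl | hs | rfl | hs
          · exact Or.inl h4.le
          · exact Or.inl (hle hs)
          · exact Or.inl le_rfl
          · exact Or.inr hs
        · exact Or.inr hs
    · have hall : (all || decide (r.height < i.height + 1)) = all := by
        cases all <;> simp_all
      have hslot : ∀ s, (s, true) ∈ (cons u d i r).marks k all →
          (k < i.height + 1 ∧ s ≤ d) ∨ (s, true) ∈ r.marks k all := by
        intro s hs
        simp only [marks, if_neg hc, hall] at hs
        split_ifs at hs with hk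
        · simp only [List.mem_cons, List.mem_append, Prod.mk.injEq, and_true] at hs
          rcases hs with rfl | hs | rfl | hs
          · exact Or.inl ⟨hk, h4.le⟩
          · exact Or.inl ⟨hk, hle hs⟩
          · exact Or.inl ⟨hk, le_rfl⟩
          · exact Or.inr hs
        · exact Or.inr (by simpa using hs)
        · exact Or.inr hs
      rcases List.mem_cons.1 hγ with rfl | h
      · have hpu : u ≤ p ∧ p ≤ d := by
          simp only [Soliton.boxes, List.mem_append, List.mem_cons, List.not_mem_nil,
            or_false] at hp
          rcases hp with (rfl | hp) | hp | rfl
          · exact ⟨le_rfl, h4.le⟩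
          · exact ⟨(h1 _ (mem_word_of_mem_spineUp hp)).le, (h3 _ (mem_word_of_mem_spineUp hp)).le⟩
          · exact ⟨(h1 _ (mem_word_of_mem_spineDown hp)).le,
              (h3 _ (mem_word_of_mem_spineDown hp)).le⟩
          · exact ⟨h4.le, le_rfl⟩
        refine ⟨hpu.1, fun hk s hs hlt => ?_⟩
        simp only [Soliton.size, List.length_cons, length_spineUp] at hk
        rcases hslot s hs with hs | hs
        · omega
        · exact hpu.2.trans_lt (h2 s (hmem hs))
      · rcases List.mem_append.1 h with h | h
        · exact hins h
        · exact hrest _ h fun s hs => (hslot s hs).imp_left And.right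

/-- Each branch of size `m > k` contributes `2 (m - k)` boxes to the `k`-slots. -/
theorem count_true_marks (k : ℕ) (all : Bool) (F : BoxForest) :
    ((F.marks k all).map Prod.snd).count true =
      2 * ((F.branches all).map fun γ => γ.size - k).sum +
        (if all then 0 else 2 * (F.height - k)) := by
  induction F generalizing all with
  | nil => cases all <;> simp [marks, branches, height]
  | cons u d i r hi hr =>
    have hsmall : i.height + 1 ≤ k → ((i.branches false).map fun γ => γ.size - k).sum = 0 := by
      intro hk
      refine List.sum_eq_zero fun x hx => ?_
      obtain ⟨γ, hγ, rfl⟩ := List.mem_map.1 hx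
      have := size_le_height hγ
      omega
    by_cases hc : all = false ∧ r.height < i.height + 1
    · obtain ⟨rfl, hc⟩ := hc
      by_cases hk : k < i.height + 1
      · simp [marks, branches, hk, hc, hi, hr, height]
        omega
      · simp [marks, branches, hk, hc, hr, height, hsmall (by omega)]
        omega
    · have hall : (all || decide (r.height < i.height + 1)) = all := by
        cases all <;> simp_all
      have hmax : all = false → max (i.height + 1) r.height = r.height := by
        rintro rfl
        simp at hc
        omega
      by_cases hk : k < i.height + 1
      · simp only [marks, branches, if_pos hk, if_neg hc, hall, List.map_cons, List.map_append,
          List.count_append, List.count_cons_self, hi, hr, List.sum_cons, List.sum_append,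
          Soliton.size, List.length_cons, length_spineUp, height]
        cases all
        · simp [hmax]; omega
        · simp; omega
      · have hlhs : (((cons u d i r).marks k all).map Prod.snd).count true =
            ((r.marks k all).map Prod.snd).count true := by
          simp only [marks, if_neg hk, if_neg hc]
          split_ifs <;> simp
        rw [hlhs, hr]
        simp only [branches, if_neg hc, List.map_cons, List.map_append, List.sum_cons,
          List.sum_append, Soliton.size, List.length_cons, length_spineUp, height]
        have := hsmall (by omega)
        simp only [Soliton.size] at this
        rw [this]
        cases all
        · simp [hmax]; omega
        · simp; omega

/-! ### The slot diagram of the tree -/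

/-- The forest without its labels. -/
def toTrees : BoxForest → List PlaneTree
  | nil => []
  | cons _ _ i r => .node i.toTrees :: r.toTrees

open PlaneTree in
@[simp] theorem maxGeneration_toTrees (F : BoxForest) : maxGeneration F.toTrees = F.height := by
  induction F with
  | nil => simp [toTrees, maxGeneration, height]
  | cons u d i r hi hr => simp [toTrees, maxGeneration, height, generation, hi, hr]

/-- The numbers that come with the arcs that are slots. -/
def slotValues (l : List (Bool × ℕ)) : List ℕ := (l.filter fun p => p.1).map fun p => p.2

theorem slotValues_append (l l' : List (Bool × ℕ)) :
    slotValues (l ++ l') = slotValues l ++ slotValues l' := by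
  simp [slotValues]

theorem slotValues_cons (b : Bool) (a : ℕ) (l : List (Bool × ℕ)) :
    slotValues ((b, a) :: l) = if b then a :: slotValues l else slotValues l := by
  cases b <;> simp [slotValues]

open PlaneTree in
/-- The slots of the tree, together with the numbers of branches attached to them, are read off from
the marks in the word. The four cases are: the node is the root or has generation number larger
than `k + 1`; it has generation number `k + 1` and the offspring with its colour is still to be
visited; it has generation number `k + 1` and this offspring has been visited; its generation
number is at most `k`. -/
theorem slotValues_arcsAux {k : ℕ} (F : BoxForest) (isRoot : Bool) (g : ℕ)
    (passed : Bool) (a : ℕ) (hg : F.height ≤ g) :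
    ((isRoot = true ∨ k < g) → slotValues (arcsAux k isRoot g passed a F.toTrees) =
      counts a ((F.marks k (isRoot || decide (F.height < g))).map Prod.snd)) ∧
    (isRoot = false → g = k → passed = false → F.height = g →
      slotValues (arcsAux k isRoot g passed a F.toTrees) =
        counts a ((F.marks k false).map Prod.snd)) ∧
    (isRoot = false → g = k → passed = true → F.height < g →
      slotValues (arcsAux k isRoot g passed a F.toTrees) = []) ∧
    (isRoot = false → g < k → slotValues (arcsAux k isRoot g passed a F.toTrees) = []) := by
  induction F generalizing isRoot g passed a with
  | nil =>
    simp only [toTrees, arcsAux, marks, List.map_nil, counts, slotValues_cons]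
    refine ⟨fun h => ?_, fun h1 h2 h3 _ => ?_, fun h1 h2 h3 _ => ?_, fun h1 h2 => ?_⟩
    · rcases h with h | h <;> simp [h, slotValues]
    · simp [h2, h3, slotValues]
    · simp [h1, h2, h3, slotValues]
    · simp [h1, h2.ne, h2.le, slotValues]
  | cons u d i r hi hr =>
    simp only [height, max_le_iff] at hg
    obtain ⟨hgi, hgr⟩ := hg
    have hgen : (node i.toTrees).generation = i.height + 1 := by simp [generation]
    have hcont : continuesBranch isRoot g (node i.toTrees) r.toTrees =
        (!isRoot && (i.height + 1 == g) && decide (r.height < g)) := by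
      simp [continuesBranch, hgen]
    have harcs : slotValues (arcs k false (node i.toTrees)) =
        if k ≤ i.height then counts 0 ((i.marks k false).map Prod.snd) else [] := by
      obtain ⟨h1, h2, -, h4⟩ := hi false i.height false 0 le_rfl
      simp only [arcs, maxGeneration_toTrees]
      split_ifs with hk
      · rcases hk.lt_or_eq with hk | hk
        · simpa using h1 (Or.inr hk)
        · exact h2 rfl hk.symm rfl rfl
      · exact h4 rfl (by omega)
    simp only [toTrees, arcsAux, hcont, hgen]
    generalize hcb : (!isRoot && (i.height + 1 == g) && decide (r.height < g)) = c
    obtain ⟨r1, r2, r3, r4⟩ := hr isRoot g (passed || i.height + 1 == k) 0 hgr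
    cases c with
    | true =>
      -- The leftmost offspring has the colour of its parent.
      simp only [Bool.and_eq_true, Bool.not_eq_true', beq_iff_eq, decide_eq_true_eq] at hcb
      obtain ⟨⟨rfl, rfl⟩, hlt⟩ := hcb
      have hmax : max (i.height + 1) r.height = i.height + 1 := by omega
      simp only [Bool.true_eq_false, false_and, if_false, slotValues_cons, slotValues_append, harcs]
      refine ⟨fun h => ?_, fun _ h2 h3 _ => ?_, fun _ _ _ h => ?_, fun _ h => ?_⟩
      · have hk : k < i.height + 1 := by simpa using h
        have hk' : k ≤ i.height := by omega
        rw [r1 (Or.inr hk)]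
        simp [hk, hk', marks, height, hlt, hmax, counts, counts_append_true]
      · subst h2
        rw [r3 rfl rfl (by simp) hlt]
        simp [h3, marks, hlt, marks_eq_nil hlt, counts]
      · simp only [height] at h; omega
      · rw [r4 rfl h]
        simp [h.ne, show ¬ k ≤ i.height by omega]
    | false =>
      obtain ⟨s1, s2, s3, s4⟩ := hr isRoot g passed a hgr
      obtain ⟨t1, t2, t3, t4⟩ := hr isRoot g passed (a + 1) hgr
      -- The leftmost offspring is the lowest node of a branch, and `marks` treats it as such.
      have hnc : ¬ ((isRoot || decide ((cons u d i r).height < g)) = false ∧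
          r.height < i.height + 1) := by
        rintro ⟨h, h'⟩
        simp only [height, Bool.or_eq_false_iff] at h
        have h2 := of_decide_eq_false h.2
        have : i.height + 1 = g := by omega
        simp [h.1, this] at hcb
        omega
      have hflag : (isRoot || decide ((cons u d i r).height < g)) =
          (isRoot || decide (r.height < g)) := by
        cases isRoot
        · by_cases h : r.height < g
          · have : i.height + 1 ≠ g := by simpa [h] using hcb
            simp [height, h]; omega
          · simp [height, h]
        · rfl
      have hnc' : isRoot = false → (cons u d i r).height = g →
          r.height = g ∧ ¬ r.height < i.height + 1 := by
        rintro rfl h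
        simp only [height] at h
        by_contra hcon
        have h1 : i.height + 1 = g := by omega
        simp [h1] at hcb
        omega
      rcases lt_trichotomy (i.height + 1) k with hk | hk | hk
      · -- A branch with fewer than `k` nodes is erased and leaves no mark.
        simp only [hk, and_self, if_true]
        refine ⟨fun h => ?_, fun h1 h2 h3 h4 => ?_, fun h1 h2 h3 h4 => ?_, s4⟩
        · rw [s1 h, marks, if_neg (by omega), if_neg hnc, if_neg (by omega), hflag]
        · obtain ⟨h5, h6⟩ := hnc' h1 h4
          rw [s2 h1 h2 h3 h5, marks, if_neg (by omega), if_neg (by simp [h6]),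
            if_neg (by omega)]
        · exact s3 h1 h2 h3 ((le_max_right _ _).trans_lt h4)
      · simp only [hk, lt_irrefl, and_false, if_false, and_self, if_true]
        refine ⟨fun h => ?_, fun h1 h2 h3 h4 => ?_, fun h1 h2 h3 h4 => ?_, t4⟩
        · rw [t1 h, marks, if_neg (by omega), if_neg hnc, if_pos hk, hflag]
          rfl
        · obtain ⟨h5, h6⟩ := hnc' h1 h4
          rw [t2 h1 h2 h3 h5, marks, if_neg (by omega), if_neg (by simp [h6]), if_pos hk]
          rfl
        · exact t3 h1 h2 h3 ((le_max_right _ _).trans_lt h4)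
      · simp only [show ¬ i.height + 1 < k by omega, show ¬ i.height + 1 = k by omega, and_false,
          if_false, slotValues_cons, slotValues_append, harcs, show k ≤ i.height by omega, if_true]
        refine ⟨fun h => ?_, ?_, ?_, ?_⟩
        · rw [r1 h, marks, if_pos hk, hflag]
          have hflag' : (isRoot || decide (r.height < g) || decide (r.height < i.height + 1)) =
              (isRoot || decide (r.height < g)) := by
            rw [hflag] at hnc
            generalize (isRoot || decide (r.height < g)) = b at hnc
            cases b <;> simp_all
          rw [hflag']
          rcases h with h | h <;> simp [h, counts, counts_append_true]
        all_goals intros; omega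

end BoxForest

/-! ### The labelled forest of an excursion -/

open BoxForest

/-- The forest of the excursion `ε`, when the first step of `ε` is in the box `s`. The nodes are
the matched pairs of an up-step and a down-step, with their boxes. -/
def boxForest (s : ℕ) (ε : DyckWord) : BoxForest :=
  if h : ε = 0 then .nil
  else .cons s (s + 2 * ε.insidePart.semilength + 1) (boxForest (s + 1) ε.insidePart)
    (boxForest (s + 2 * ε.insidePart.semilength + 2) ε.outsidePart)
termination_by ε.semilength
decreasing_by
  · exact DyckWord.semilength_insidePart_lt h
  · exact DyckWord.semilength_outsidePart_lt h

theorem toTrees_boxForest (s : ℕ) (ε : DyckWord) : (boxForest s ε).toTrees = forest ε := by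
  induction s, ε using boxForest.induct with
  | case1 s => rw [boxForest, forest]; simp [toTrees]
  | case2 s ε h hi hr => rw [boxForest, forest, dif_neg h, dif_neg h, toTrees, hi, hr]

theorem word_boxForest (s : ℕ) (ε : DyckWord) :
    (boxForest s ε).word = List.range' s (2 * ε.semilength) := by
  induction s, ε using boxForest.induct with
  | case1 s => rw [boxForest]; simp [word]
  | case2 s ε h hi hr =>
    rw [boxForest, dif_neg h, word, hi, hr,
      ← DyckWord.semilength_insidePart_add_semilength_outsidePart_add_one h]
    rw [show 2 * (ε.insidePart.semilength + ε.outsidePart.semilength + 1) =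
      2 * ε.insidePart.semilength + (2 * ε.outsidePart.semilength + 1) + 1 by ring,
      List.range'_succ, ← List.range'_append_1, List.range'_succ]
    rw [show s + 1 + 2 * ε.insidePart.semilength = s + 2 * ε.insidePart.semilength + 1 by ring]

theorem toList_eq_of_ne_zero {ε : DyckWord} (h : ε ≠ 0) :
    ε.toList =
      DyckStep.U :: (ε.insidePart.toList ++ DyckStep.D :: ε.outsidePart.toList) := by
  conv_lhs => rw [← DyckWord.nest_insidePart_add_outsidePart h]
  change ([DyckStep.U] ++ ε.insidePart.toList ++ [DyckStep.D]) ++ ε.outsidePart.toList = _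
  simp

theorem coloured_boxForest {η : ℕ → Bool} (s : ℕ) (ε : DyckWord)
    (hη : ∀ i < 2 * ε.semilength, η (s + i) = (ε.toList[i]? == some DyckStep.U)) :
    (boxForest s ε).Coloured η := by
  induction s, ε using boxForest.induct with
  | case1 s => rw [boxForest]; simp [Coloured]
  | case2 s ε h hi hr =>
    have hlen := DyckWord.semilength_insidePart_add_semilength_outsidePart_add_one h
    have hl := ε.insidePart.two_mul_semilength_eq_length
    rw [toList_eq_of_ne_zero h] at hη
    rw [boxForest, dif_neg h]
    refine ⟨?_, ?_, hi fun i hlt => ?_, hr fun i hlt => ?_⟩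
    · simpa using hη 0 (by omega)
    · rw [add_assoc, hη _ (by omega), List.getElem?_cons_succ,
        List.getElem?_append_right (by omega)]
      simp [hl]
    · rw [add_assoc, add_comm 1, hη _ (by omega), List.getElem?_cons_succ,
        List.getElem?_append_left (by omega)]
    · rw [show s + 2 * ε.insidePart.semilength + 2 + i =
        s + (2 * ε.insidePart.semilength + (i + 1) + 1) by ring, hη _ (by omega),
        List.getElem?_cons_succ, List.getElem?_append_right (by omega), hl,
        Nat.add_sub_cancel_left, List.getElem?_cons_succ]

theorem two_mul_length_branches_le (all : Bool) (F : BoxForest) :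
    2 * (F.branches all).length ≤ F.word.length := by
  induction F generalizing all with
  | nil => simp [branches]
  | cons u d i r hi hr =>
    have h1 := hi false
    simp only [branches, word]
    split_ifs
    · have h2 := hr true
      simp only [List.length_append, List.length_cons]
      omega
    · have h2 := hr all
      simp only [List.length_append, List.length_cons]
      omega

theorem framed_boxForest (ε : DyckWord) :
    (boxForest 1 ε).framed 0 (2 * ε.semilength + 1) = List.range (2 * ε.semilength + 2) := by
  rw [framed, word_boxForest, List.range_succ, List.range_succ_eq_map, List.range'_eq_map_range]
  simp [Nat.add_comm 1]

theorem perm_htSolitons (ε : DyckWord) :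
    (htSolitons ε).Perm ((boxForest 1 ε).branches true) := by
  rw [htSolitons, ← framed_boxForest]
  refine perm_htLoop_branches rfl ?_ _ (coloured_boxForest 1 ε fun i _ => ?_) ?_ ?_
  · simp [ball, ε.two_mul_semilength_eq_length]
  · rw [add_comm]; rfl
  · rw [framed_boxForest]; exact List.nodup_range
  · have := two_mul_length_branches_le true (boxForest 1 ε)
    rw [word_boxForest, List.length_range'] at this
    omega

/-! ### The two slot diagrams -/

theorem filter_mem_eq_of_sublist {α : Type*} [DecidableEq α] {l l' : List α}
    (h : l'.Sublist l) (hl : l.Nodup) : l.filter (fun x => x ∈ l') = l' := by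
  induction h with
  | slnil => rfl
  | @cons l₁ l₂ a hs ih =>
    rw [List.nodup_cons] at hl
    rw [List.filter_cons_of_neg (by simpa using fun h => hl.1 (hs.subset h)), ih hl.2]
  | @cons_cons l₁ l₂ a hs ih =>
    rw [List.nodup_cons] at hl
    rw [List.filter_cons_of_pos (by simp)]
    conv_rhs => rw [← ih hl.2]
    congr 1
    refine List.filter_congr fun x hx => ?_
    have : x ≠ a := by rintro rfl; exact hl.1 hx
    simp [this]

theorem pairwise_word_boxForest (s : ℕ) (ε : DyckWord) :
    (boxForest s ε).word.Pairwise (· < ·) := by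
  rw [word_boxForest]
  exact List.pairwise_lt_range'

theorem htSlots_eq (ε : DyckWord) (k : ℕ) :
    htSlots ε k = 0 :: separators ((boxForest 1 ε).marks k true) := by
  have hiff : ∀ p, IsHTSlot ε k p ↔ p = 0 ∨ p ∈ separators ((boxForest 1 ε).marks k true) := by
    intro p
    rw [mem_separators, mem_marks_iff]
    simp only [IsHTSlot, (perm_htSolitons ε).mem_iff, Soliton.HasSlot, Bool.true_eq_false,
      false_and, or_false]
  have hsub : (separators ((boxForest 1 ε).marks k true)).Sublist (boxForest 1 ε).word :=
    (List.filter_sublist.map _).trans (marks_sublist_word k true _)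
  have hnd := (pairwise_word_boxForest 1 ε).imp (S := (· ≠ ·)) fun h => ne_of_lt h
  rw [htSlots, List.range_eq_range', List.range'_succ, Nat.zero_add, ← word_boxForest,
    List.filter_cons_of_pos (by simp [hiff])]
  conv_rhs => rw [← filter_mem_eq_of_sublist hsub hnd]
  congr 1
  refine List.filter_congr fun p hp => ?_
  have : p ≠ 0 := by
    rw [word_boxForest, List.mem_range'_1] at hp
    omega
  simp [hiff, this]

theorem htVector_eq (ε : DyckWord) (k : ℕ) :
    htVector ε k = counts 0 (((boxForest 1 ε).marks k true).map Prod.snd) := by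
  have hw := pairwise_word_boxForest 1 ε
  have hmem : ∀ p ∈ (boxForest 1 ε).word, 0 < p ∧ p < 2 * ε.semilength + 1 := by
    intro p hp
    rw [word_boxForest, List.mem_range'_1] at hp
    omega
  have hsub := marks_sublist_word k true (boxForest 1 ε)
  -- A soliton is between two slots if its first box is.
  have hcount : ∀ x ∈ 0 :: separators ((boxForest 1 ε).marks k true),
      ∀ y ∈ separators ((boxForest 1 ε).marks k true) ++ [2 * ε.semilength + 1],
      ((htSolitons ε).countP fun γ => γ.size = k ∧ ∀ j ∈ γ.boxes, x < j ∧ j < y) =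
        ((boxForest 1 ε).marks k true).countP fun q => !q.2 ∧ x < q.1 ∧ q.1 < y := by
    intro x _ y hy
    have h1 : ((boxForest 1 ε).marks k true).countP (fun q => !q.2 ∧ x < q.1 ∧ q.1 < y) =
        ((((boxForest 1 ε).marks k true).filter fun q => !q.2).map Prod.fst).countP
          fun p => x < p ∧ p < y := by
      rw [List.countP_map, List.countP_filter]
      refine List.countP_congr fun q _ => ?_
      simp
      tauto
    rw [(perm_htSolitons ε).countP_eq, h1, ← map_first_filter_branches, List.countP_map,
      List.countP_filter]
    refine List.countP_congr fun γ hγ => ?_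
    simp only [decide_eq_true_eq, Bool.and_eq_true, Function.comp_apply]
    constructor
    · rintro ⟨h2, h3⟩
      exact ⟨h3 _ (first_mem_boxes hγ), h2⟩
    · rintro ⟨⟨h3, h4⟩, h2⟩
      refine ⟨h2, fun j hj => ?_⟩
      obtain ⟨h5, h6⟩ := boxes_of_mem_branches (k := k) hw hγ hj
      refine ⟨h3.trans_le h5, ?_⟩
      rcases List.mem_append.1 hy with hy | hy
      · exact h6 h2 y (mem_separators.1 hy) h4
      · rw [List.mem_singleton.1 hy]
        exact (hmem j (mem_word_of_mem_boxes hγ hj)).2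
  rw [htVector, htSlots_eq, List.tail_cons]
  refine zipWith_separators _ _ _ _ _ (hw.sublist hsub)
    (fun q hq => (hmem _ (hsub.subset (List.mem_map_of_mem hq))).2) (fun y hy => ?_)
    (fun x hx y hy => hcount x (by simp [hx]) y hy)
  rw [hcount 0 (by simp) y hy, Nat.zero_add]
  refine List.countP_congr fun q hq => ?_
  simp [(hmem _ (hsub.subset (List.mem_map_of_mem hq))).1]

theorem slotVector_tree (ε : DyckWord) (k : ℕ) :
    (tree ε).slotVector k = counts 0 (((boxForest 1 ε).marks k true).map Prod.snd) := by
  have h := (slotValues_arcsAux (k := k) (boxForest 1 ε) true (boxForest 1 ε).height false 0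
    le_rfl).1 (Or.inl rfl)
  rw [Bool.true_or] at h
  rw [← h, tree, PlaneTree.slotVector, PlaneTree.arcs, ← toTrees_boxForest 1, maxGeneration_toTrees]
  rfl

theorem exists_size_eq_height {F : BoxForest} (h : 0 < F.height) :
    ∃ γ ∈ F.branches true, γ.size = F.height := by
  induction F with
  | nil => simp [height] at h
  | cons u d i r _ hr =>
    simp only [branches, height, Bool.true_eq_false, false_and, if_false]
    by_cases hlt : i.height + 1 < r.height
    · obtain ⟨γ, hγ, hs⟩ := hr (by omega)
      exact ⟨γ, by simp [hγ], by omega⟩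
    · exact ⟨_, List.mem_cons_self, by simp [Soliton.size]; omega⟩

theorem htMax_eq (ε : DyckWord) : htMax ε = (boxForest 1 ε).height := by
  apply le_antisymm
  · refine List.max_le_of_forall_le _ _ fun m hm => ?_
    obtain ⟨γ, hγ, rfl⟩ := List.mem_map.1 hm
    exact size_le_height ((perm_htSolitons ε).mem_iff.1 hγ)
  · rcases Nat.eq_zero_or_pos (boxForest 1 ε).height with h | h
    · omega
    · obtain ⟨γ, hγ, hs⟩ := exists_size_eq_height h
      exact List.le_max_of_le
        (List.mem_map_of_mem (f := Soliton.size) ((perm_htSolitons ε).mem_iff.2 hγ)) hs.ge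

theorem component_htSlotDiagram {ε : DyckWord} {k : ℕ} (h1 : 1 ≤ k) (h2 : k ≤ htMax ε) :
    component (htSlotDiagram ε) k = htVector ε k := by
  rw [component, htSlotDiagram, List.getD_eq_getElem _ _ (by simp; omega)]
  simp [Nat.sub_add_cancel h1]

theorem count_false_marks (k : ℕ) (F : BoxForest) :
    ((F.marks k true).map Prod.snd).count false =
      (F.branches true).countP fun γ => γ.size = k := by
  have h := congrArg List.length (map_first_filter_branches k true F)
  rw [List.length_map, List.length_map, ← List.countP_eq_length_filter,
    ← List.countP_eq_length_filter] at h
  rw [h, List.count, List.countP_map]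
  refine List.countP_congr fun q _ => ?_
  simp

/-- Summation over the branches by size. -/
theorem sum_size_sub (k M : ℕ) (Γ : List Soliton) (h : ∀ γ ∈ Γ, γ.size ≤ M) :
    (Γ.map fun γ => γ.size - k).sum =
      ∑ m ∈ Finset.Ioc k M, (m - k) * Γ.countP fun γ => γ.size = m := by
  induction Γ with
  | nil => simp
  | cons γ Γ ih =>
    have hγ := h γ (by simp)
    simp only [List.map_cons, List.sum_cons, List.countP_cons, decide_eq_true_eq, mul_add,
      Finset.sum_add_distrib, mul_ite, mul_one, mul_zero, Finset.sum_ite_eq, Finset.mem_Ioc]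
    rw [ih fun γ' h' => h γ' (by simp [h'])]
    split_ifs <;> omega

theorem isSlotDiagram_htSlotDiagram (ε : DyckWord) : IsSlotDiagram (htSlotDiagram ε) := by
  have hlen : (htSlotDiagram ε).length = htMax ε := by simp [htSlotDiagram]
  intro k h1 h2
  rw [hlen] at h2 ⊢
  rw [component_htSlotDiagram h1 h2, htVector_eq, length_counts, count_true_marks,
    sum_size_sub k (htMax ε) _ fun γ hγ => (size_le_height hγ).trans (htMax_eq ε).ge]
  simp only [if_true, add_zero]
  congr 2
  refine Finset.sum_congr rfl fun m hm => ?_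
  rw [Finset.mem_Ioc] at hm
  rw [component_htSlotDiagram (by omega) hm.2, htVector_eq, sum_counts, count_false_marks,
    Nat.zero_add]

theorem htSlotDiagram_eq_treeSlotDiagram (ε : DyckWord) :
    htSlotDiagram ε = treeSlotDiagram ε := by
  have hgen : (tree ε).generation - 1 = htMax ε := by
    rw [htMax_eq, tree, PlaneTree.generation, ← toTrees_boxForest 1, maxGeneration_toTrees,
      Nat.add_sub_cancel]
  rw [htSlotDiagram, treeSlotDiagram, PlaneTree.slotDiagram, hgen]
  refine List.map_congr_left fun j _ => ?_
  rw [htVector_eq, slotVector_tree]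

end BoxBall

theorem proposition4p2 (ε : DyckWord) :
    BoxBall.IsSlotDiagram (BoxBall.htSlotDiagram ε) ∧
      BoxBall.htSlotDiagram ε = BoxBall.treeSlotDiagram ε :=
  ⟨BoxBall.isSlotDiagram_htSlotDiagram ε, BoxBall.htSlotDiagram_eq_treeSlotDiagram ε⟩
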